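/- Let $n\in\mathbb N$ and let $\sigma_0,\sigma_1,\sigma_2,\sigma_3$ be the Pauli matrices $I,X,Y,Z$. For $\alpha\in\{0,1,2,3\}^n$ write $P_\alpha=\bigotimes_i\sigma_{\alpha_i}$, and for a Pauli string $P$ write $R_P(t)=e^{-iPt/2}$. Consider an $n$-qubit circuit $$U(\theta)=W_KR_K(\theta)\cdots W_1R_1(\theta)\,W_0R_0(\theta)$$ (the right-most factor acts first), where each $W_k$ is a Clifford gate, each $R_k(\theta)=\prod_l R_{P_{kl}}(\theta_{kl})$ is a product of rotations generated by arbitrary Pauli strings, and $R_0$ begins with a layer of single-qubit rotations generated by $\sigma_{\nu_i}$ on qubit $i=1,\dots,n$, followed by a layer of single-qubit rotations generated by $\sigma_{\mu_i}$ on qubit $i=1,\dots,n$, with $\mu_i,\nu_i\in\{1,2,3\}$ and $\mu_i\ne\nu_i$ for all $i$. Every rotation has its own parameter; let $m$ be the number of parameters. $\operatorname{Var}_\theta$ is the variance when the parameters are independent and uniform on $[-\pi,\pi]$, and $\mathbb E_{\mathcal D}$ is the expectation over the uniform distribution on $\{0,\pi/2\}^m$. For a mixed state $\rho$ and an observable $H=\sum_\alpha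 c_\alpha P_\alpha$, $c_\alpha\in\mathbb R$, let $\mathcal L(\theta)=\operatorname{Tr}(U(\theta)\rho U(\theta)^\dagger H)$ and $\mathcal L_\alpha(\theta)=\operatorname{Tr}(U(\theta)\rho U(\theta)^\dagger P_\alpha)$. Let $\ell_\alpha(\theta)$ (the light-cone) be the number of qubits on which $U(\theta)^\dagger P_\alpha U(\theta)$ acts non-trivially, and put $$\Omega(\rho)=\sum_{\lambda:\ \lambda_i\notin\{0,\nu_i\}\ \forall i}\operatorname{Tr}(P_\lambda\rho)^2,\qquad \Omega(\rho,\beta)=\sum_{\lambda\in\Lambda(\beta)}\operatorname{Tr}(P_\lambda\rho)^2,$$ where $\Lambda(\beta)$ is the set of all $\lambda\in\{0,1,2,3\}^n$ such that, for every $i$: $\lambda_i=0$ if $\beta_i=0$; $\lambda_i\notin\{0,\nu_i\}$ if $\beta_i=\mu_i$; and $\lambda_i\neq0$ otherwise. **Theorem.** For every such circuit and every mixed state $\rho$: 1. For every observable $H=\sum_\alpha c_\alpha P_\alpha$ and every parameter $\theta_k$, $$\operatorname{Var}_\theta[\mathcal L]=\sum_\alpha c_\alpha^2\operatorname{Var}_\theta[\mathcal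 L_\alpha],\qquad \operatorname{Var}_\theta[\partial_k\mathcal L]=\sum_\alpha c_\alpha^2\operatorname{Var}_\theta[\partial_k\mathcal L_\alpha].$$ 2. For every $\alpha\ne0$, $\ \max_k\operatorname{Var}_\theta[\partial_k\mathcal L_\alpha]=\operatorname{Var}_\theta[\mathcal L_\alpha]=\mathbb E_{\mathcal D}[\mathcal L_\alpha^2]$. 3. For every $\alpha\neq0$, if $\rho=\bigotimes_i\rho_i$ is a product of single-qubit mixed states, then $$\Omega(\rho)\,\mathbb E_{\mathcal D}\big[(1/4)^{\ell_\alpha(\theta)}\big]\le\operatorname{Var}_\theta[\mathcal L_\alpha]\le\mathbb E_{\mathcal D}\big[(1/2)^{\ell_\alpha(\theta)}\big].$$ In particular at least one $\operatorname{Var}_\theta[\partial_k\mathcal L_\alpha]$ satisfies the lower bound, and all of them satisfy the upper bound. 4. For every $\alpha\ne0$ and arbitrary $\rho$: let $A(\theta)$ be the part of the circuit after the two initial layers. For $\theta\in\{0,\pi/2\}^m$ there is $\alpha(\theta)$ with $A(\theta)^\dagger P_\alpha A(\theta)=\pm P_{\alpha(\theta)}$, and $$\mathbb E_{\mathcal D}\big[\Omega(\rho,\alpha(\theta))(1/4)^{\ell_\alpha(\theta)}\big]\le\operatorname{Var}_\theta[\mathcal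 L_\alpha]\le\mathbb E_{\mathcal D}\big[\Omega(\rho,\alpha(\theta))(3/4)^{\ell_\alpha(\theta)}\big].$$ Moreover, both bounds in 3 can be attained: for every $\alpha\ne0$ there are a circuit and a product mixed state $\rho$ with $\Omega(\rho)>0$ for which the lower bound in 3 is an equality, and a circuit and a product mixed state for which the upper bound in 3 is an equality. -/

import Mathlib

open scoped ComplexOrder

noncomputable section

/-! ### Qubits, Pauli strings, states -/

/-- Operators on `n` qubits, as matrices in the computational basis `{0,1}ⁿ`. -/
abbrev QOp (n : ℕ) : Type := Matrix (Fin n → Fin 2) (Fin n → Fin 2) ℂ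

/-- The tensor product `A₁ ⊗ ⋯ ⊗ Aₙ` of single-qubit operators. -/
def tensor {n : ℕ} (A : Fin n → Matrix (Fin 2) (Fin 2) ℂ) : QOp n :=
  Matrix.of fun x y => ∏ i, A i (x i) (y i)

/-- The Pauli matrices `σ₀ = I`, `σ₁ = X`, `σ₂ = Y`, `σ₃ = Z`. -/
def pauli : Fin 4 → Matrix (Fin 2) (Fin 2) ℂ :=
  ![1, !![0, 1; 1, 0], !![0, -Complex.I; Complex.I, 0], !![1, 0; 0, -1]]

/-- Indices `α ∈ {0,1,2,3}ⁿ` of Pauli strings. -/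
abbrev PauliIndex (n : ℕ) : Type := Fin n → Fin 4

/-- The Pauli string `P_α = σ_{α₁} ⊗ ⋯ ⊗ σ_{αₙ}`. -/
def pauliString {n : ℕ} (α : PauliIndex n) : QOp n :=
  tensor fun i => pauli (α i)

/-- The observable `H = ∑_α c_α P_α` with real Pauli coefficients `c_α`. -/
def observable {n : ℕ} (c : PauliIndex n → ℝ) : QOp n :=
  ∑ α, (c α : ℂ) • pauliString α

/-- A mixed state (density matrix): positive semidefinite of trace one. -/
def IsMixedState {d : Type} [Fintype d] (ρ : Matrix d d ℂ) : Prop :=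
  ρ.PosSemidef ∧ ρ.trace = 1

/-- A product mixed state `ρ = ρ₁ ⊗ ⋯ ⊗ ρₙ`. -/
def IsProductState {n : ℕ} (ρ : QOp n) : Prop :=
  ∃ r : Fin n → Matrix (Fin 2) (Fin 2) ℂ, (∀ i, IsMixedState (r i)) ∧ ρ = tensor r

/-! ### Gates and circuits -/

/-- The rotation gate `R_P(t) = exp(-i t P / 2)` generated by the Pauli string `P = P_α`. -/
def pauliRotation {n : ℕ} (α : PauliIndex n) (t : ℝ) : QOp n :=
  NormedSpace.exp ((-(Complex.I * (t / 2 : ℝ))) • pauliString α)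

/-- The `n`-qubit Pauli group: Pauli strings with phases `±1, ±i`. -/
def pauliGroup (n : ℕ) : Set (QOp n) :=
  {Q | ∃ (z : ℂ) (α : PauliIndex n), z ^ 4 = 1 ∧ Q = z • pauliString α}

/-- Clifford gates: unitaries that normalize the Pauli group. -/
def IsClifford {n : ℕ} (W : QOp n) : Prop :=
  W ∈ Matrix.unitaryGroup (Fin n → Fin 2) ℂ ∧
    ∀ Q : QOp n, W * Q * W.conjTranspose ∈ pauliGroup n ↔ Q ∈ pauliGroup n

/-- A parameterized circuit `U(θ) = W_K R_K(θ) ⋯ W₁ R₁(θ) W₀ R₀(θ)` (the right-most factor acts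
first), where each `W k` is Clifford, `R_k` for `k ≥ 1` is the product of the rotations generated by
the arbitrary Pauli strings `P k l`, `l < L k`, and `R₀` starts with the layer of single-qubit
rotations `σ_{ν_i}`, followed by the layer of single-qubit rotations `σ_{μ_i}`, followed by the
rotations generated by `P 0 l`, `l < L 0`. The two single-qubit layers are orthogonal:
`ν_i, μ_i ∈ {1,2,3}` and `ν_i ≠ μ_i` on every qubit. -/
structure PauliCircuit (n : ℕ) where
  K : ℕ
  W : Fin (K + 1) → QOp n
  clifford : ∀ k, IsClifford (W k)
  L : Fin (K + 1) → ℕ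
  P : (k : Fin (K + 1)) → Fin (L k) → PauliIndex n
  ν : PauliIndex n
  μ : PauliIndex n
  ν_ne_zero : ∀ i, ν i ≠ 0
  μ_ne_zero : ∀ i, μ i ≠ 0
  μ_ne_ν : ∀ i, μ i ≠ ν i

namespace PauliCircuit

variable {n : ℕ} (C : PauliCircuit n)

/-- The parameters of the circuit, one for each rotation gate: first-layer rotations, second-layer
rotations, all other rotations. -/
abbrev Param : Type := Fin n ⊕ Fin n ⊕ (Σ k : Fin (C.K + 1), Fin (C.L k))

/-- The first layer of rotations, `∏_i R_{σ_{ν_i}}(θ)`. -/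
def firstLayer (θ : C.Param → ℝ) : QOp n :=
  (List.ofFn fun i => pauliRotation (Pi.single i (C.ν i)) (θ (.inl i))).prod

/-- The second layer of rotations, `∏_i R_{σ_{μ_i}}(θ)`. -/
def secondLayer (θ : C.Param → ℝ) : QOp n :=
  (List.ofFn fun i => pauliRotation (Pi.single i (C.μ i)) (θ (.inr (.inl i)))).prod

/-- The product of the rotations with generators `P k l`, larger `l` further to the left. -/
def rotations (θ : C.Param → ℝ) (k : Fin (C.K + 1)) : QOp n :=
  (List.ofFn fun l => pauliRotation (C.P k l) (θ (.inr (.inr ⟨k, l⟩)))).reverse.prod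

/-- The part of the circuit after the two initial layers. -/
def tail (θ : C.Param → ℝ) : QOp n :=
  (List.ofFn fun k => C.W k * C.rotations θ k).reverse.prod

/-- The circuit unitary `U(θ)`. -/
def unitary (θ : C.Param → ℝ) : QOp n :=
  C.tail θ * C.secondLayer θ * C.firstLayer θ

/-- The loss `Tr(U(θ) ρ U(θ)† H)`, a real number for Hermitian `ρ` and `H`. -/
def loss (ρ H : QOp n) (θ : C.Param → ℝ) : ℝ :=
  (C.unitary θ * ρ * (C.unitary θ).conjTranspose * H).trace.re

end PauliCircuit

/-- The operator `A` acts trivially on qubit `i`, that is, `A = I ⊗ A'` with the identity on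
qubit `i` and `A'` an operator on the other qubits. -/
def ActsTriviallyOn {n : ℕ} (A : QOp n) (i : Fin n) : Prop :=
  ∀ (x y : Fin n → Fin 2) (b : Fin 2),
    A x y = if x i = y i then A (Function.update x i b) (Function.update y i b) else 0

/-- The light-cone: the number of qubits on which `U(θ)† P_α U(θ)` acts non-trivially. -/
def PauliCircuit.lightCone {n : ℕ} (C : PauliCircuit n) (α : PauliIndex n)
    (θ : C.Param → ℝ) : ℕ :=
  {i : Fin n | ¬ ActsTriviallyOn
    ((C.unitary θ).conjTranspose * pauliString α * C.unitary θ) i}.ncard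

/-! ### Averages over parameters -/

/-- The law of independent parameters, each uniform on `[-π, π]`. -/
def uniformParams (ι : Type) [Fintype ι] : MeasureTheory.Measure (ι → ℝ) :=
  MeasureTheory.Measure.pi fun _ =>
    ProbabilityTheory.cond MeasureTheory.volume (Set.Icc (-Real.pi) Real.pi)

/-- The expectation under the uniform distribution on the finite set `{0, π/2}^ι`. -/
def discreteMean {ι : Type} [Fintype ι] [DecidableEq ι] (f : (ι → ℝ) → ℝ) : ℝ :=
  (∑ b : ι → Bool, f fun k => if b k then Real.pi / 2 else 0) / 2 ^ Fintype.card ι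

/-- The variance under independent uniform parameters. -/
def paramVar {ι : Type} [Fintype ι] (f : (ι → ℝ) → ℝ) : ℝ :=
  ProbabilityTheory.variance f (uniformParams ι)

/-- The partial derivative with respect to the parameter `k`. -/
def partialDeriv {ι : Type} [DecidableEq ι] (k : ι) (f : (ι → ℝ) → ℝ) (θ : ι → ℝ) : ℝ :=
  deriv (fun t => f (Function.update θ k t)) (θ k)

/-! ### Orthogonality of a state and the initial layers -/

open Classical in
/-- `Ω(ρ)`: the sum of `Tr(P_λ ρ)²` over all `λ` with `λ_i ∉ {0, ν_i}` for every `i`. -/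
def orthogonality {n : ℕ} (ν : PauliIndex n) (ρ : QOp n) : ℝ :=
  ∑ l : PauliIndex n with ∀ i, l i ≠ 0 ∧ l i ≠ ν i, ((pauliString l * ρ).trace.re) ^ 2

open Classical in
/-- `Ω(ρ, α)`: the sum of `Tr(P_λ ρ)²` over all `λ` such that, for every `i`, `λ_i = 0` if
`α_i = 0`, `λ_i ∉ {0, ν_i}` if `α_i = μ_i`, and `λ_i ≠ 0` otherwise. -/
def genOrthogonality {n : ℕ} (ν μ : PauliIndex n) (ρ : QOp n) (α : PauliIndex n) : ℝ :=
  ∑ l : PauliIndex n with ∀ i, (α i = 0 → l i = 0) ∧ (α i = μ i → l i ≠ 0 ∧ l i ≠ ν i) ∧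
      (α i ≠ 0 → α i ≠ μ i → l i ≠ 0),
    ((pauliString l * ρ).trace.re) ^ 2

end

/-! ### Tensor products and Pauli strings -/

open Matrix

/-! In the Heisenberg picture a rotation acts by `R_G(t)† A R_G(t) = A₀ + cos t · A₁ + sin t · A₂`,
where `A₀` and `A₁` are the parts of `A` commuting and anticommuting with `P_G`, and `A₂ =
(i/2)[P_G, A]`. As every gate has its own parameter, the loss is a trigonometric polynomial of
degree at most one in each variable, with monomials `s` choosing `1`, `cos` or `sin` per parameter
(`Gate.sum_coeff`, `loss_eq_trigSum`). On a Pauli string only `1` survives at a commuting gate and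
only `cos`, `sin` at an anticommuting one, so a monomial selects at most one trajectory of strings
(`Gate.path`).

Two facts drive parts 1 and 2. A monomial determines the string it started from: in the two
orthogonal layers it records commutation with `σ_μ` and then with `σ_ν`, which identifies the Pauli
matrix on each qubit, and the remaining gates are injective (`path_gates_injective`). Hence distinct
Pauli terms share no monomial and variances add; and the constant monomial belongs to the identity,
so other terms have mean zero. Secondly, two different monomials of one string first separate at an
anticommuting gate, as `cos` against `sin` (`Gate.path_eq_none_or`). Since `cos · sin` vanishes at
`0` and `π/2`, where `cos²` and `sin²` still average to `1/2`, the discrete second moment equals the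
continuous one. A partial derivative keeps exactly the monomials involving its variable, and the
variable of the first anticommuting gate lies in all of them.

For parts 3 and 4, fix the discrete angles after the two layers. The string is then a fixed `γ` up
to sign, and the average over the layer angles is governed qubit by qubit by `layerCount`, the
number of the four angle pairs taking `σ_g` to `σ_a`. It is `4` for `g = a = 0`, is `1` or `2` when
`g ≠ 0` and the transition is allowed, and is `0` otherwise. Comparison with `4 · 1/4`, `4 · 1/2`,
`4 · 3/4`, together with the Bloch ball inequality for product states, gives the bounds. -/

theorem tensor_mul {n : ℕ} (A B : Fin n → Matrix (Fin 2) (Fin 2) ℂ) :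
    tensor A * tensor B = tensor fun i => A i * B i := by
  ext x y
  simp only [tensor, Matrix.mul_apply, Matrix.of_apply, Finset.prod_univ_sum,
    Fintype.piFinset_univ, Finset.prod_mul_distrib]

theorem trace_tensor {n : ℕ} (A : Fin n → Matrix (Fin 2) (Fin 2) ℂ) :
    (tensor A).trace = ∏ i, (A i).trace := by
  simp only [tensor, Matrix.trace, Matrix.diag, Matrix.of_apply, Finset.prod_univ_sum,
    Fintype.piFinset_univ]

theorem conjTranspose_tensor {n : ℕ} (A : Fin n → Matrix (Fin 2) (Fin 2) ℂ) :
    (tensor A)ᴴ = tensor fun i => (A i)ᴴ := by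
  ext x y
  simp [tensor, Matrix.conjTranspose_apply]

theorem tensor_smul {n : ℕ} (z : Fin n → ℂ) (A : Fin n → Matrix (Fin 2) (Fin 2) ℂ) :
    (tensor fun i => z i • A i) = (∏ i, z i) • tensor A := by
  ext x y
  simp [tensor, Finset.prod_mul_distrib]

theorem tensor_one {n : ℕ} : tensor (fun _ : Fin n => (1 : Matrix (Fin 2) (Fin 2) ℂ)) = 1 := by
  ext x y
  simp only [tensor, Matrix.of_apply, Matrix.one_apply, Finset.prod_ite_zero,
    Finset.mem_univ, true_implies, Finset.prod_const_one, funext_iff]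

/-- Index of the product of two Pauli matrices, up to phase. -/
def mulIndex : Fin 4 → Fin 4 → Fin 4 :=
  ![![0, 1, 2, 3], ![1, 0, 3, 2], ![2, 3, 0, 1], ![3, 2, 1, 0]]

/-- Phase of the product of two Pauli matrices. -/
noncomputable def mulPhase : Fin 4 → Fin 4 → ℂ :=
  ![![1, 1, 1, 1], ![1, 1, Complex.I, -Complex.I], ![1, -Complex.I, 1, Complex.I],
    ![1, Complex.I, -Complex.I, 1]]

/-- The sign with which two Pauli matrices commute. -/
def commSign (a b : Fin 4) : ℤ := if a = 0 ∨ b = 0 ∨ a = b then 1 else -1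

theorem pauli_mul (a b : Fin 4) : pauli a * pauli b = mulPhase a b • pauli (mulIndex a b) := by
  fin_cases a <;> fin_cases b <;> ext i j <;> fin_cases i <;> fin_cases j <;>
    simp [pauli, mulPhase, mulIndex, Matrix.mul_apply, Fin.sum_univ_two]

theorem mulPhase_pow (a b : Fin 4) : mulPhase a b ^ 4 = 1 := by
  have h : (-Complex.I) ^ 4 = 1 := by
    rw [Even.neg_pow (by decide), Complex.I_pow_four]
  fin_cases a <;> fin_cases b <;> simp [mulPhase, h]

theorem pauli_comm (a b : Fin 4) :
    pauli a * pauli b = (commSign a b : ℂ) • (pauli b * pauli a) := by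
  fin_cases a <;> fin_cases b <;> ext i j <;> fin_cases i <;> fin_cases j <;>
    simp [pauli, commSign, Matrix.mul_apply, Fin.sum_univ_two]

theorem conjTranspose_pauli (a : Fin 4) : (pauli a)ᴴ = pauli a := by
  fin_cases a <;> ext i j <;> fin_cases i <;> fin_cases j <;>
    simp [pauli, Matrix.conjTranspose_apply]

theorem pauli_mul_self (a : Fin 4) : pauli a * pauli a = 1 := by
  fin_cases a <;> ext i j <;> fin_cases i <;> fin_cases j <;>
    simp [pauli, Matrix.mul_apply, Fin.sum_univ_two, Matrix.one_apply]

theorem trace_pauli_mul_pauli (a b : Fin 4) :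
    (pauli a * pauli b).trace = if a = b then 2 else 0 := by
  fin_cases a <;> fin_cases b <;>
    norm_num [pauli, Matrix.trace, Matrix.mul_apply, Fin.sum_univ_two, Matrix.one_apply]

/-- Index of the product of two Pauli strings, up to phase. -/
def PauliIndex.mul {n : ℕ} (α β : PauliIndex n) : PauliIndex n := fun i => mulIndex (α i) (β i)

/-- Commutation of Pauli strings in terms of their indices. -/
def PauliIndex.Commutes {n : ℕ} (α β : PauliIndex n) : Prop :=
  ∏ i, commSign (α i) (β i) = 1

instance {n : ℕ} (α β : PauliIndex n) : Decidable (α.Commutes β) :=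
  inferInstanceAs (Decidable (_ = _))

theorem mulIndex_right_injective (a b g : Fin 4) : mulIndex a g = mulIndex b g → a = b := by
  revert a b g; decide

theorem PauliIndex.mul_right_injective {n : ℕ} {α β γ : PauliIndex n}
    (h : α.mul γ = β.mul γ) : α = β :=
  funext fun i => mulIndex_right_injective _ _ _ (congrFun h i)

theorem pauliString_mul {n : ℕ} (α β : PauliIndex n) :
    ∃ z : ℂ, z ^ 4 = 1 ∧ pauliString α * pauliString β = z • pauliString (α.mul β) := by
  refine ⟨∏ i, mulPhase (α i) (β i), ?_, ?_⟩
  · rw [← Finset.prod_pow]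
    exact Finset.prod_eq_one fun i _ => mulPhase_pow _ _
  · simp only [pauliString, tensor_mul, pauli_mul, tensor_smul]
    rfl

theorem pauliString_comm {n : ℕ} (α β : PauliIndex n) :
    pauliString α * pauliString β =
      ((∏ i, commSign (α i) (β i) : ℤ) : ℂ) • (pauliString β * pauliString α) := by
  simp only [pauliString, tensor_mul]
  rw [Int.cast_prod, ← tensor_smul]
  simp only [← pauli_comm]

theorem prod_commSign {n : ℕ} (α β : PauliIndex n) :
    ∏ i, commSign (α i) (β i) = 1 ∨ ∏ i, commSign (α i) (β i) = -1 := by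
  rw [← Int.isUnit_iff]
  refine IsUnit.prod_univ_iff.2 fun i => ?_
  rw [Int.isUnit_iff]
  unfold commSign
  split_ifs <;> simp

theorem PauliIndex.Commutes.comm {n : ℕ} {α β : PauliIndex n} (h : α.Commutes β) :
    pauliString α * pauliString β = pauliString β * pauliString α := by
  rw [pauliString_comm, h]; simp

theorem PauliIndex.anticomm {n : ℕ} {α β : PauliIndex n} (h : ¬ α.Commutes β) :
    pauliString α * pauliString β = -(pauliString β * pauliString α) := by
  rw [pauliString_comm, (prod_commSign α β).resolve_left h]; simp

theorem PauliIndex.zero_commutes {n : ℕ} (β : PauliIndex n) : (0 : PauliIndex n).Commutes β := by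
  simp [PauliIndex.Commutes, commSign]

theorem conjTranspose_pauliString {n : ℕ} (α : PauliIndex n) :
    (pauliString α)ᴴ = pauliString α := by
  simp [pauliString, conjTranspose_tensor, conjTranspose_pauli]

theorem pauliString_mul_self {n : ℕ} (α : PauliIndex n) : pauliString α * pauliString α = 1 := by
  simp [pauliString, tensor_mul, pauli_mul_self, tensor_one]

theorem pauliString_zero {n : ℕ} : pauliString (0 : PauliIndex n) = 1 := by
  simp [pauliString, pauli, tensor_one]

theorem trace_pauliString_mul {n : ℕ} (α β : PauliIndex n) :
    (pauliString α * pauliString β).trace = if α = β then 2 ^ n else 0 := by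
  simp only [pauliString, tensor_mul, trace_tensor, trace_pauli_mul_pauli, Finset.prod_ite_zero,
    Finset.mem_univ, true_implies, funext_iff, Finset.prod_const, Finset.card_univ,
    Fintype.card_fin]

theorem pauliString_ne_zero {n : ℕ} (α : PauliIndex n) : pauliString α ≠ 0 := fun h => by
  have h1 := trace_pauliString_mul α α
  rw [h, Matrix.zero_mul, Matrix.trace_zero, if_pos rfl] at h1
  exact pow_ne_zero n two_ne_zero h1.symm

/-- Trace orthogonality: pairing both sides with `P_α` gives `2 ^ n` against `0` if the indices
differ. -/
theorem eq_of_pauliString_eq_smul {n : ℕ} {α β : PauliIndex n} {z : ℂ}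
    (h : pauliString α = z • pauliString β) : α = β := by
  by_contra hne
  have h1 := trace_pauliString_mul α α
  nth_rw 2 [h] at h1
  rw [Matrix.mul_smul, Matrix.trace_smul, trace_pauliString_mul, if_neg hne, if_pos rfl, smul_zero] at h1
  exact pow_ne_zero n two_ne_zero h1.symm

/-- A Hermitian element of the Pauli group is a Pauli string up to sign. -/
theorem sign_of_isHermitian {n : ℕ} {Q : QOp n} (hQ : Qᴴ = Q) {z : ℂ} (hz : z ^ 4 = 1)
    {α : PauliIndex n} (h : Q = z • pauliString α) :
    Q = pauliString α ∨ Q = -pauliString α := by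
  have h1 : star z = z := by
    have h2 : (star z - z) • pauliString α = 0 := by
      have h3 := hQ
      rw [h, Matrix.conjTranspose_smul, conjTranspose_pauliString] at h3
      rw [sub_smul, h3, sub_self]
    exact sub_eq_zero.1 ((smul_eq_zero.1 h2).resolve_right (pauliString_ne_zero α))
  obtain ⟨r, rfl⟩ := Complex.conj_eq_iff_real.1 h1
  have h3 : r ^ 4 = 1 := by exact_mod_cast hz
  -- Being Hermitian makes the phase real, and `±1` are the only real fourth roots of unity.
  have h4 : (r - 1) * (r + 1) = 0 := by nlinarith [sq_nonneg (r ^ 2 - 1), sq_nonneg r]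
  rcases mul_eq_zero.1 h4 with h5 | h5
  · left; rw [h, sub_eq_zero.1 h5]; simp
  · right; rw [h, eq_neg_of_add_eq_zero_left h5]; simp

/-- Clifford gates map Pauli strings to Pauli strings, up to sign. -/
theorem IsClifford.exists_index {n : ℕ} {W : QOp n} (hW : IsClifford W) (α : PauliIndex n) :
    ∃ β, Wᴴ * pauliString α * W = pauliString β ∨ Wᴴ * pauliString α * W = -pauliString β := by
  have hWW : W * Wᴴ = 1 := Matrix.mem_unitaryGroup_iff.1 hW.1
  -- The equivalence in `IsClifford` is used backwards: conjugating `W† P_α W` by `W` returns `P_α`.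
  have h : Wᴴ * pauliString α * W ∈ pauliGroup n := by
    refine (hW.2 _).1 ⟨1, α, by simp, ?_⟩
    rw [one_smul]
    calc W * (Wᴴ * pauliString α * W) * Wᴴ = (W * Wᴴ) * pauliString α * (W * Wᴴ) := by
          simp only [Matrix.mul_assoc]
      _ = _ := by rw [hWW, Matrix.one_mul, Matrix.mul_one]
  obtain ⟨z, β, hz, h⟩ := h
  refine ⟨β, sign_of_isHermitian ?_ hz h⟩
  simp [Matrix.conjTranspose_mul, conjTranspose_pauliString, Matrix.mul_assoc]

open Classical in
/-- The index of `W† P_α W`, up to sign. -/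
noncomputable def cliffordIndex {n : ℕ} (W : QOp n) (α : PauliIndex n) : PauliIndex n :=
  if h : ∃ β, Wᴴ * pauliString α * W = pauliString β ∨ Wᴴ * pauliString α * W = -pauliString β
  then h.choose else 0

theorem IsClifford.cliffordIndex_spec {n : ℕ} {W : QOp n} (hW : IsClifford W)
    (α : PauliIndex n) : Wᴴ * pauliString α * W = pauliString (cliffordIndex W α) ∨
      Wᴴ * pauliString α * W = -pauliString (cliffordIndex W α) := by
  have h := hW.exists_index α
  rw [cliffordIndex, dif_pos h]
  exact h.choose_spec

/-- Makes the chosen index independent of the choice, since proportional Pauli strings have equal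
indices. -/
theorem eq_cliffordIndex {n : ℕ} {W : QOp n} (hW : IsClifford W) {α β : PauliIndex n} {z : ℂ}
    (h : pauliString β = z • (Wᴴ * pauliString α * W)) : β = cliffordIndex W α := by
  rcases hW.cliffordIndex_spec α with h' | h' <;> rw [h'] at h
  · exact eq_of_pauliString_eq_smul h
  · rw [smul_neg, ← neg_smul] at h
    exact eq_of_pauliString_eq_smul h

theorem IsClifford.cliffordIndex_zero {n : ℕ} {W : QOp n} (hW : IsClifford W) :
    cliffordIndex W 0 = 0 := by
  refine (eq_cliffordIndex (z := 1) hW ?_).symm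
  rw [pauliString_zero, Matrix.mul_one, one_smul]
  exact (Matrix.mem_unitaryGroup_iff'.1 hW.1).symm

theorem IsClifford.cliffordIndex_injective {n : ℕ} {W : QOp n} (hW : IsClifford W) :
    Function.Injective (cliffordIndex W) := by
  intro α β h
  have hWW : W * Wᴴ = 1 := Matrix.mem_unitaryGroup_iff.1 hW.1
  have h1 : ∀ Q : QOp n, W * (Wᴴ * Q * W) * Wᴴ = Q := fun Q => by
    calc W * (Wᴴ * Q * W) * Wᴴ = (W * Wᴴ) * Q * (W * Wᴴ) := by
          simp only [Matrix.mul_assoc]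
      _ = _ := by rw [hWW, Matrix.one_mul, Matrix.mul_one]
  have key : ∃ z : ℂ, Wᴴ * pauliString α * W = z • (Wᴴ * pauliString β * W) := by
    rcases hW.cliffordIndex_spec α with h2 | h2 <;> rcases hW.cliffordIndex_spec β with h3 | h3 <;>
      rw [h2, h3, h]
    exacts [⟨1, by simp⟩, ⟨-1, by simp⟩, ⟨-1, by simp⟩, ⟨1, by simp⟩]
  obtain ⟨z, hz⟩ := key
  refine eq_of_pauliString_eq_smul (z := z) ?_
  rw [← h1 (pauliString α), hz, Matrix.mul_smul, Matrix.smul_mul, h1]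

theorem pauliString_apply {n : ℕ} (α : PauliIndex n) (i : Fin n) (x y : Fin n → Fin 2) :
    pauliString α x y =
      pauli (α i) (x i) (y i) * ∏ j ∈ Finset.univ.erase i, pauli (α j) (x j) (y j) :=
  (Finset.mul_prod_erase _ (fun j => pauli (α j) (x j) (y j)) (Finset.mem_univ i)).symm

theorem pauliString_update {n : ℕ} (α : PauliIndex n) (i : Fin n) (x y : Fin n → Fin 2)
    (b : Fin 2) : pauliString α (Function.update x i b) (Function.update y i b) =
      pauli (α i) b b * ∏ j ∈ Finset.univ.erase i, pauli (α j) (x j) (y j) := by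
  rw [pauliString_apply α i, Function.update_self, Function.update_self]
  congr 1
  refine Finset.prod_congr rfl fun j hj => ?_
  rw [Function.update_of_ne (Finset.ne_of_mem_erase hj),
    Function.update_of_ne (Finset.ne_of_mem_erase hj)]

/-- A Pauli string acts trivially exactly where its index vanishes. -/
theorem actsTriviallyOn_pauliString {n : ℕ} (α : PauliIndex n) (i : Fin n) :
    ActsTriviallyOn (pauliString α) i ↔ α i = 0 := by
  constructor
  · intro h
    by_contra hi
    -- The column of the nonzero entry in row `0`: `X` and `Y` flip the bit, `I` and `Z` keep it.
    obtain ⟨y, hy⟩ : ∃ y : Fin n → Fin 2, y = fun j => if α j = 1 ∨ α j = 2 then 1 else 0 :=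
      ⟨_, rfl⟩
    have hne : ∀ j, pauli (α j) 0 (y j) ≠ 0 := by
      intro j
      simp only [hy]
      generalize α j = a
      fin_cases a <;> simp [pauli]
    have h1 := h (fun _ => 0) y 1
    rw [pauliString_update, pauliString_apply α i] at h1
    have h5 : ∏ j ∈ Finset.univ.erase i, pauli (α j) 0 (y j) ≠ 0 :=
      Finset.prod_ne_zero_iff.2 fun j _ => hne j
    -- For `X`, `Y` a nonzero entry is off-diagonal on qubit `i`; for `Z`, flipping that bit on both
    -- sides changes the sign.
    by_cases h3 : α i = 1 ∨ α i = 2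
    · rw [if_neg (by simp [hy, h3])] at h1
      exact mul_ne_zero (hne i) h5 h1
    · have hyi : y i = 0 := by simp [hy, h3]
      have h4 : α i = 3 := by
        generalize α i = a at hi h3
        revert a; decide
      rw [if_pos hyi.symm] at h1
      have h6 := mul_right_cancel₀ h5 h1
      have h7 : pauli 3 = !![1, 0; 0, -1] := rfl
      rw [h4, hyi, h7] at h6
      norm_num [Complex.ext_iff] at h6
  · intro h x y b
    rw [pauliString_update, pauliString_apply α i, h]
    have : pauli 0 = 1 := rfl
    simp [this, Matrix.one_apply]

theorem actsTriviallyOn_neg {n : ℕ} (A : QOp n) (i : Fin n) :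
    ActsTriviallyOn (-A) i ↔ ActsTriviallyOn A i := by
  unfold ActsTriviallyOn
  refine forall_congr' fun x => forall_congr' fun y => forall_congr' fun b => ?_
  split_ifs <;> simp

/-! ### Heisenberg evolution along lists of gates -/

/-- A gate of a circuit with parameters in `ι`: a Clifford gate or a Pauli rotation. -/
inductive Gate (ι : Type) (n : ℕ) where
  | fixed (W : QOp n) (h : IsClifford W)
  | rot (k : ι) (G : PauliIndex n)

namespace Gate

variable {ι : Type} {n : ℕ}

/-- The unitary matrix of a gate. -/
noncomputable def mat (θ : ι → ℝ) : Gate ι n → QOp n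
  | fixed W _ => W
  | rot k G => pauliRotation G (θ k)

/-- The parameters that occur in a list of gates. -/
def params : List (Gate ι n) → List ι
  | [] => []
  | fixed _ _ :: l => params l
  | rot k _ :: l => k :: params l

theorem params_append (l l' : List (Gate ι n)) : params (l ++ l') = params l ++ params l' := by
  induction l with
  | nil => rfl
  | cons g l ih => cases g <;> simp [params, ih]

end Gate

/-- Conjugation `A ↦ V† A V` as a linear map. -/
noncomputable def conjMap {n : ℕ} (V : QOp n) : QOp n →ₗ[ℂ] QOp n :=
  LinearMap.mulRight ℂ V ∘ₗ LinearMap.mulLeft ℂ Vᴴ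

theorem conjMap_apply {n : ℕ} (V A : QOp n) : conjMap V A = Vᴴ * A * V := rfl

/-- The components of `R_G(t)† A R_G(t)` along `1`, `cos t` and `sin t`. -/
noncomputable def rotComponent {n : ℕ} (G : PauliIndex n) (j : Fin 3) : QOp n →ₗ[ℂ] QOp n :=
  ![(1 / 2 : ℂ) • (LinearMap.id + conjMap (pauliString G)),
    (1 / 2 : ℂ) • (LinearMap.id - conjMap (pauliString G)),
    (Complex.I / 2) • (LinearMap.mulLeft ℂ (pauliString G) -
      LinearMap.mulRight ℂ (pauliString G))] j

/-- The functions `1`, `cos`, `sin`. -/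
noncomputable def trig (t : ℝ) : Fin 3 → ℝ := ![1, Real.cos t, Real.sin t]

-- The powers of `P` alternate between `1` and `P`, so the exponential series splits into its even
-- and odd parts.
open Nat in
theorem exp_smul_of_mul_self_eq_one {𝔸 : Type*} [NormedRing 𝔸] [NormedAlgebra ℂ 𝔸]
    [CompleteSpace 𝔸] {P : 𝔸} (hP : P * P = 1) (z : ℂ) :
    NormedSpace.exp (z • P) = (Complex.cosh z) • (1 : 𝔸) + Complex.sinh z • P := by
  -- Writing the parity indicators as `(1 ± (-1)^k)/2` turns the two parts into combinations of the
  -- scalar series at `z` and `-z`.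
  have hpow : ∀ k : ℕ, P ^ k = ((1 + (-1) ^ k) / 2 : ℂ) • (1 : 𝔸) +
      ((1 - (-1) ^ k) / 2 : ℂ) • P := by
    intro k
    rcases Nat.even_or_odd' k with ⟨m, rfl | rfl⟩
    · simp [pow_mul, pow_two, hP]
    · simp [pow_succ, pow_mul, hP, ← two_mul]
  have h1 := NormedSpace.exp_series_hasSum_exp' (𝕂 := ℂ) (z • P)
  have h2 : ∀ w : ℂ, HasSum (fun k : ℕ => (k !⁻¹ : ℂ) * w ^ k) (Complex.exp w) := fun w => by
    simpa [Complex.exp_eq_exp_ℂ] using NormedSpace.exp_series_hasSum_exp' (𝕂 := ℂ) w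
  have h3 := (((h2 z).add (h2 (-z))).div_const 2).smul_const (1 : 𝔸)
  have h4 := (((h2 z).sub (h2 (-z))).div_const 2).smul_const P
  refine (h1.unique ?_)
  convert h3.add h4 using 1
  · funext k
    rw [smul_pow, hpow, smul_add, smul_add, smul_smul, smul_smul, smul_smul, smul_smul, neg_pow z]
    congr 2 <;> ring
  · rw [Complex.cosh, Complex.sinh]

theorem pauliRotation_eq {n : ℕ} (G : PauliIndex n) (t : ℝ) :
    pauliRotation G t = (Real.cos (t / 2) : ℂ) • (1 : QOp n) -
      (Complex.I * Real.sin (t / 2)) • pauliString G := by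
  have h : NormedSpace.exp ((-(Complex.I * (t / 2 : ℝ))) • pauliString G) =
      Complex.cosh (-(Complex.I * (t / 2 : ℝ))) • (1 : QOp n) +
        Complex.sinh (-(Complex.I * (t / 2 : ℝ))) • pauliString G := by
    -- A norm serves only the convergence of the series; the statement does not involve it.
    open scoped Matrix.Norms.Operator in
    exact exp_smul_of_mul_self_eq_one (pauliString_mul_self G) _
  rw [pauliRotation, h, Complex.cosh_neg, Complex.sinh_neg, mul_comm, Complex.cosh_mul_I,
    Complex.sinh_mul_I, neg_smul, ← sub_eq_add_neg, mul_comm _ Complex.I]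
  simp

/-- Half-angle formulas: the `PAP` term carries `sin²(t/2) = (1 - cos t)/2`, and the cross terms
form a commutator with factor `sin(t/2) cos(t/2) = (sin t)/2`. -/
theorem conj_pauliRotation {n : ℕ} (G : PauliIndex n) (t : ℝ) (A : QOp n) :
    (pauliRotation G t)ᴴ * A * pauliRotation G t = ∑ j, (trig t j : ℂ) • rotComponent G j A := by
  have h1 : ((Real.cos t : ℝ) : ℂ) = 2 * (Real.cos (t / 2) : ℂ) ^ 2 - 1 := by
    rw [← Complex.ofReal_pow, ← mul_div_cancel₀ t (two_ne_zero' ℝ), Real.cos_two_mul]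
    simp
  have h2 : ((Real.sin t : ℝ) : ℂ) = 2 * Real.sin (t / 2) * Real.cos (t / 2) := by
    rw [← mul_div_cancel₀ t (two_ne_zero' ℝ), Real.sin_two_mul]
    simp
  have h3 : (Real.sin (t / 2) : ℂ) ^ 2 = 1 - (Real.cos (t / 2) : ℂ) ^ 2 := by
    rw [← Complex.ofReal_pow, Real.sin_sq]; simp
  rw [pauliRotation_eq]
  simp only [Matrix.conjTranspose_sub, Matrix.conjTranspose_smul, conjTranspose_pauliString,
    Matrix.conjTranspose_one, Fin.sum_univ_three, trig, rotComponent, Matrix.cons_val]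
  simp only [LinearMap.smul_apply, LinearMap.add_apply, LinearMap.sub_apply, conjMap_apply,
    conjTranspose_pauliString, LinearMap.id_apply, LinearMap.mulLeft_apply,
    LinearMap.mulRight_apply, h1, h2]
  generalize (Real.cos (t / 2)) = c at *
  generalize (Real.sin (t / 2)) = s at *
  generalize pauliString G = P
  simp only [Matrix.sub_mul, Matrix.mul_sub, Matrix.smul_mul, Matrix.mul_smul, Matrix.one_mul,
    Matrix.mul_one, star_mul', Complex.star_def, Complex.conj_I, Complex.conj_ofReal]
  have h4 : (c : ℂ) ^ 2 = 1 - (s : ℂ) ^ 2 := by rw [h3]; ring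
  ext x y
  simp only [Matrix.sub_apply, Matrix.add_apply, Matrix.smul_apply, smul_eq_mul,
    Complex.ofReal_one]
  linear_combination (P * A * P) x y * h4 - (s : ℂ) ^ 2 * (P * A * P) x y * Complex.I_sq

namespace Gate

variable {ι : Type} {n : ℕ}

/-- The operator-valued coefficient of a trigonometric monomial in the Heisenberg evolution. -/
noncomputable def coeff (s : ι → Fin 3) : List (Gate ι n) → QOp n →ₗ[ℂ] QOp n
  | [] => LinearMap.id
  | fixed W _ :: l => coeff s l ∘ₗ conjMap W
  | rot k G :: l => coeff s l ∘ₗ rotComponent G (s k)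

/-- The evolution obtained by giving the three components of every rotation the weights `p k`. -/
noncomputable def evolve (p : ι → Fin 3 → ℝ) : List (Gate ι n) → QOp n →ₗ[ℂ] QOp n
  | [] => LinearMap.id
  | fixed W _ :: l => evolve p l ∘ₗ conjMap W
  | rot k G :: l => evolve p l ∘ₗ ∑ j, (p k j : ℂ) • rotComponent G j

theorem evolve_trig (θ : ι → ℝ) (l : List (Gate ι n)) (A : QOp n) :
    evolve (fun k => trig (θ k)) l A =
      ((l.map (mat θ)).prod)ᴴ * A * (l.map (mat θ)).prod := by
  induction l generalizing A with
  | nil => simp [evolve]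
  | cons g l ih =>
    cases g with
    | fixed W h =>
      simp only [evolve, LinearMap.comp_apply, ih, conjMap_apply, List.map_cons, List.prod_cons,
        mat, Matrix.conjTranspose_mul, Matrix.mul_assoc]
    | rot k G =>
      simp only [evolve, LinearMap.comp_apply, ih, List.map_cons, List.prod_cons,
        mat, Matrix.conjTranspose_mul, LinearMap.sum_apply, LinearMap.smul_apply]
      rw [← conj_pauliRotation]
      simp only [Matrix.mul_assoc]

theorem evolve_congr {p q : ι → Fin 3 → ℝ} {l : List (Gate ι n)}
    (h : ∀ k ∈ params l, p k = q k) : evolve p l = evolve q l := by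
  induction l with
  | nil => rfl
  | cons g l ih =>
    cases g with
    | fixed W _ => simp only [evolve, ih h]
    | rot k G =>
      simp only [params, List.mem_cons, forall_eq_or_imp] at h
      simp only [evolve, ih h.2, h.1]

variable [Fintype ι] [DecidableEq ι]

/-- Arbitrary weights replace `trig (θ k)` to make the induction work: removing a rotation freezes
its weight to a point mass, so the weights of absent parameters need only sum to one. Distinctness
of the parameters ensures that the frozen one does not recur. -/
theorem sum_coeff (p : ι → Fin 3 → ℝ) (l : List (Gate ι n)) (hl : (params l).Nodup)
    (hp : ∀ k ∉ params l, ∑ j, p k j = 1) (A : QOp n) :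
    ∑ s : ι → Fin 3, ((∏ k, p k (s k) : ℝ) : ℂ) • coeff s l A = evolve p l A := by
  induction l generalizing A p with
  | nil =>
    simp only [coeff, evolve, ← Finset.sum_smul, ← Complex.ofReal_sum]
    rw [← Fintype.piFinset_univ, ← Finset.prod_univ_sum, Finset.prod_eq_one]
    · simp
    · exact fun k _ => hp k (by simp [params])
  | cons g l ih =>
    cases g with
    | fixed W _ => exact ih p hl hp _
    | rot k G =>
      simp only [params, List.nodup_cons] at hl
      simp only [evolve, coeff, LinearMap.comp_apply, LinearMap.sum_apply, map_sum,
        LinearMap.smul_apply, map_smul]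
      have key : ∀ j, evolve p l (rotComponent G j A) =
          ∑ s : ι → Fin 3, ((∏ i, Function.update p k (Pi.single j 1) i (s i) : ℝ) : ℂ) •
            coeff s l (rotComponent G j A) := by
        intro j
        rw [ih _ hl.2]
        · rw [evolve_congr]
          intro i hi
          rw [Function.update_of_ne]
          rintro rfl
          exact hl.1 hi
        · intro i hi
          by_cases hik : i = k
          · subst hik; simp
          · rw [Function.update_of_ne hik]
            exact hp i (by simp [params, hik, hi])
      simp only [key, Finset.smul_sum]
      rw [Finset.sum_comm]
      refine Finset.sum_congr rfl fun s _ => ?_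
      -- The point mass at `j` kills every monomial with `s k ≠ j`.
      rw [Finset.sum_eq_single (s k)]
      · rw [smul_smul, ← Complex.ofReal_mul]
        congr 2
        rw [← Finset.mul_prod_erase _ _ (Finset.mem_univ k),
          ← Finset.mul_prod_erase _ _ (Finset.mem_univ k)]
        simp only [Function.update_self, Pi.single_eq_same, one_mul]
        congr 1
        refine Finset.prod_congr rfl fun i hi => ?_
        rw [Function.update_of_ne (Finset.ne_of_mem_erase hi)]
      · intro j _ hj
        rw [Finset.prod_eq_zero (Finset.mem_univ k)]
        · simp
        · rw [Function.update_self, Pi.single_eq_of_ne (Ne.symm hj)]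
      · simp

end Gate

/-! ### Action of the rotation components on Pauli strings, and trajectories. -/

theorem conjMap_pauliString_of_commutes {n : ℕ} {G α : PauliIndex n} (h : α.Commutes G) :
    conjMap (pauliString G) (pauliString α) = pauliString α := by
  rw [conjMap_apply, conjTranspose_pauliString, Matrix.mul_assoc, h.comm, ← Matrix.mul_assoc,
    pauliString_mul_self, Matrix.one_mul]

theorem conjMap_pauliString_of_not_commutes {n : ℕ} {G α : PauliIndex n} (h : ¬ α.Commutes G) :
    conjMap (pauliString G) (pauliString α) = -pauliString α := by
  rw [conjMap_apply, conjTranspose_pauliString, Matrix.mul_assoc, PauliIndex.anticomm h,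
    Matrix.mul_neg, ← Matrix.mul_assoc, pauliString_mul_self, Matrix.one_mul]

theorem rotComponent_zero_apply {n : ℕ} (G α : PauliIndex n) :
    rotComponent G 0 (pauliString α) = if α.Commutes G then pauliString α else 0 := by
  simp only [rotComponent, Matrix.cons_val, LinearMap.smul_apply, LinearMap.add_apply,
    LinearMap.id_apply]
  split_ifs with h
  · rw [conjMap_pauliString_of_commutes h, ← two_smul ℂ, smul_smul]; norm_num
  · rw [conjMap_pauliString_of_not_commutes h, add_neg_cancel, smul_zero]

theorem rotComponent_one_apply {n : ℕ} (G α : PauliIndex n) :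
    rotComponent G 1 (pauliString α) = if α.Commutes G then 0 else pauliString α := by
  simp only [rotComponent, Matrix.cons_val, LinearMap.smul_apply, LinearMap.sub_apply,
    LinearMap.id_apply]
  split_ifs with h
  · rw [conjMap_pauliString_of_commutes h, sub_self, smul_zero]
  · rw [conjMap_pauliString_of_not_commutes h, sub_neg_eq_add, ← two_smul ℂ, smul_smul]; norm_num

theorem rotComponent_two_of_commutes {n : ℕ} {G α : PauliIndex n} (h : α.Commutes G) :
    rotComponent G 2 (pauliString α) = 0 := by
  simp [rotComponent, h.comm]

theorem rotComponent_two_of_not_commutes {n : ℕ} {G α : PauliIndex n} (h : ¬ α.Commutes G) :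
    rotComponent G 2 (pauliString α) = pauliString (α.mul G) ∨
      rotComponent G 2 (pauliString α) = -pauliString (α.mul G) := by
  obtain ⟨z, hz, hmul⟩ := pauliString_mul α G
  have hI : (Complex.I : ℂ) ^ 4 = 1 := Complex.I_pow_four
  have h1 : rotComponent G 2 (pauliString α) = (-Complex.I * z) • pauliString (α.mul G) := by
    simp only [rotComponent, Matrix.cons_val, LinearMap.smul_apply, LinearMap.sub_apply,
      LinearMap.mulLeft_apply, LinearMap.mulRight_apply]
    rw [← smul_smul, ← hmul, ← neg_eq_iff_eq_neg.2 (PauliIndex.anticomm h), ← neg_add', ← two_smul ℂ,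
      smul_neg, smul_smul, neg_smul]
    congr 2
    ring
  refine sign_of_isHermitian ?_ (z := -Complex.I * z) ?_ h1
  · simp only [rotComponent, Matrix.cons_val, LinearMap.smul_apply, LinearMap.sub_apply,
      LinearMap.mulLeft_apply, LinearMap.mulRight_apply, Matrix.conjTranspose_smul,
      Matrix.conjTranspose_sub, Matrix.conjTranspose_mul, conjTranspose_pauliString]
    rw [← neg_sub, smul_neg, ← neg_smul]
    congr 1
    simp [neg_div]
  · rw [mul_pow, hz, Even.neg_pow (by decide), hI, one_mul]

namespace Gate

variable {ι : Type} {n : ℕ}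

/-- The Pauli string selected by the monomial `s` in the evolution of a Pauli string, if any. -/
noncomputable def path (s : ι → Fin 3) : List (Gate ι n) → PauliIndex n → Option (PauliIndex n)
  | [], α => some α
  | fixed W _ :: l, α => path s l (cliffordIndex W α)
  | rot k G :: l, α =>
    if s k = 0 ↔ α.Commutes G then path s l (if s k = 2 then α.mul G else α) else none

/-- The Pauli string to which a Pauli string evolves when all angles are `0` or `π/2`. -/
noncomputable def discretePath (b : ι → Bool) : List (Gate ι n) → PauliIndex n → PauliIndex n
  | [], α => α
  | fixed W _ :: l, α => discretePath b l (cliffordIndex W α)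
  | rot k G :: l, α => discretePath b l (if b k ∧ ¬ α.Commutes G then α.mul G else α)

theorem path_rot_of_iff {s : ι → Fin 3} {k : ι} {G α : PauliIndex n} (l : List (Gate ι n))
    (h : s k = 0 ↔ α.Commutes G) :
    path s (rot k G :: l) α = path s l (if s k = 2 then α.mul G else α) := by
  rw [path, if_pos h]

theorem path_rot_eq_some {s : ι → Fin 3} {k : ι} {G α β : PauliIndex n} {l : List (Gate ι n)}
    (h : path s (rot k G :: l) α = some β) :
    (s k = 0 ↔ α.Commutes G) ∧ path s l (if s k = 2 then α.mul G else α) = some β := by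
  rw [path] at h
  split_ifs at h <;> simp_all

theorem path_append (s : ι → Fin 3) (l l' : List (Gate ι n)) (α : PauliIndex n) :
    path s (l ++ l') α = (path s l α).bind (path s l') := by
  induction l generalizing α with
  | nil => rfl
  | cons g l ih =>
    cases g with
    | fixed W h => exact ih _
    | rot k G =>
      simp only [List.cons_append, path, ih]
      split_ifs <;> rfl

theorem discretePath_append (b : ι → Bool) (l l' : List (Gate ι n)) (α : PauliIndex n) :
    discretePath b (l ++ l') α = discretePath b l' (discretePath b l α) := by
  induction l generalizing α with
  | nil => rfl
  | cons g l ih => cases g <;> exact ih _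

theorem discretePath_congr {b c : ι → Bool} {l : List (Gate ι n)}
    (h : ∀ k ∈ params l, b k = c k) : discretePath b l = discretePath c l := by
  induction l with
  | nil => rfl
  | cons g l ih =>
    funext α
    cases g with
    | fixed W _ => exact congrFun (ih h) _
    | rot k G =>
      simp only [params, List.mem_cons, forall_eq_or_imp] at h
      simp only [discretePath, ih h.2, h.1]

/-- Every step is invertible once `s` is known: whether the string is multiplied by `G` depends on
`s k` only, not on the string. -/
theorem path_injective {s : ι → Fin 3} {l : List (Gate ι n)} {α β γ : PauliIndex n}
    (hα : path s l α = some γ) (hβ : path s l β = some γ) : α = β := by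
  induction l generalizing α β with
  | nil =>
    rw [path, Option.some_inj] at hα hβ
    rw [hα, hβ]
  | cons g l ih =>
    cases g with
    | fixed W h => exact h.cliffordIndex_injective (ih hα hβ)
    | rot k G =>
      have h := ih (path_rot_eq_some hα).2 (path_rot_eq_some hβ).2
      split_ifs at h
      exacts [PauliIndex.mul_right_injective h, h]

/-- The identity commutes with all generators and is fixed by Clifford gates, so it owns the
constant monomial. -/
theorem path_zero (l : List (Gate ι n)) : path (fun _ => 0) l 0 = some 0 := by
  induction l with
  | nil => rfl
  | cons g l ih =>
    cases g with
    | fixed W h => rw [path, h.cliffordIndex_zero, ih]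
    | rot k G =>
      rw [path_rot_of_iff _ (by simp [PauliIndex.zero_commutes])]
      simpa using ih

/-- Two different selected monomials differ by a cosine against a sine in some parameter. -/
theorem path_eq_none_or {s s' : ι → Fin 3} (hs : ∀ k, s k = s' k ∨ s k = 0 ∨ s' k = 0)
    {l : List (Gate ι n)} (hne : ∃ k ∈ params l, s k ≠ s' k) (α : PauliIndex n) :
    path s l α = none ∨ path s' l α = none := by
  induction l generalizing α with
  | nil => obtain ⟨k, hk, _⟩ := hne; simp [params] at hk
  | cons g l ih =>
    cases g with
    | fixed W h => exact ih hne _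
    | rot k G =>
      by_cases hk : s k = s' k
      · have hne' : ∃ k ∈ params l, s k ≠ s' k := by
          obtain ⟨j, hj, hj'⟩ := hne
          rcases List.mem_cons.1 hj with rfl | hj
          · exact absurd hk hj'
          · exact ⟨j, hj, hj'⟩
        rw [path, path, hk]
        split_ifs
        exacts [ih hne' _, ih hne' _, Or.inl rfl]
      -- At the first disagreement both trajectories carry the same string. One choice is `0`, which
      -- requires commutation, and the other is nonzero, which forbids it.
      · rw [path, path]
        by_cases hc : α.Commutes G
        · rcases (hs k).resolve_left hk with h | h
          · right; rw [if_neg]; simp only [hc, iff_true]; rwa [← h, eq_comm]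
          · left; rw [if_neg]; simp only [hc, iff_true]; rwa [← h]
        · rcases (hs k).resolve_left hk with h | h
          · left; rw [if_neg]; simp [hc, h]
          · right; rw [if_neg]; simp [hc, h]

/-- If the constant monomial is not selected, all selected monomials depend on one parameter. -/
theorem exists_param_of_path_zero {l : List (Gate ι n)} {α : PauliIndex n}
    (h : path (fun _ => 0) l α = none) :
    ∃ k, ∀ s : ι → Fin 3, s k = 0 → path s l α = none := by
  induction l generalizing α with
  | nil => simp [path] at h
  | cons g l ih =>
    cases g with
    | fixed W _ => exact ih h
    | rot k G =>
      -- While generators commute with `α`, a selected monomial must choose `1` and the string stays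
      -- `α`. The first anticommuting generator supplies the parameter.
      by_cases hc : α.Commutes G
      · rw [path_rot_of_iff _ (by simp [hc])] at h
        obtain ⟨j, hj⟩ := ih (by simpa using h)
        refine ⟨j, fun s hs => ?_⟩
        rw [path]
        split_ifs with h1 h2
        · have h3 := h1.2 hc
          rw [h2] at h3
          exact absurd h3 (by decide)
        · exact hj s hs
        · rfl
      · refine ⟨k, fun s hs => ?_⟩
        rw [path, if_neg (by simp [hc, hs])]

/-- The component along `1` kills anticommuting strings and the other two kill commuting ones, so
the coefficient vanishes where the choice in `s` contradicts the commutation. -/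
theorem coeff_of_path_eq_none {s : ι → Fin 3} {l : List (Gate ι n)} {α : PauliIndex n}
    (h : path s l α = none) : coeff s l (pauliString α) = 0 := by
  induction l generalizing α with
  | nil => simp [path] at h
  | cons g l ih =>
    cases g with
    | fixed W hW =>
      rw [coeff, LinearMap.comp_apply, conjMap_apply]
      rcases hW.cliffordIndex_spec α with h1 | h1 <;> rw [h1]
      · exact ih h
      · rw [map_neg, ih h, neg_zero]
    | rot k G =>
      rw [coeff, LinearMap.comp_apply]
      by_cases hc : α.Commutes G
      · by_cases hs : s k = 0
        · rw [hs, rotComponent_zero_apply, if_pos hc]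
          rw [path_rot_of_iff _ (by simp [hc, hs])] at h
          exact ih (by simpa [hs] using h)
        · have h1 : s k = 1 ∨ s k = 2 := by
            generalize s k = a at hs
            revert a; decide
          rcases h1 with h1 | h1 <;> rw [h1]
          · rw [rotComponent_one_apply, if_pos hc, map_zero]
          · rw [rotComponent_two_of_commutes hc, map_zero]
      · by_cases hs : s k = 0
        · rw [hs, rotComponent_zero_apply, if_neg hc, map_zero]
        · rw [path_rot_of_iff _ (by simp [hc, hs])] at h
          have h1 : s k = 1 ∨ s k = 2 := by
            generalize s k = a at hs
            revert a; decide
          rcases h1 with h1 | h1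
          · rw [h1, rotComponent_one_apply, if_neg hc]
            exact ih (by simpa [h1] using h)
          · have h2 := ih (by simpa [h1] using h)
            rw [h1]
            rcases rotComponent_two_of_not_commutes hc with h3 | h3 <;> rw [h3]
            · exact h2
            · rw [map_neg, h2, neg_zero]

/-- The angles `0` and `π/2` described by Boolean values. -/
noncomputable def angle (b : ι → Bool) : ι → ℝ := fun k => if b k then Real.pi / 2 else 0

/-- The weights of `1, cos, sin` are `1, 1, 0` at angle `0` and `1, 0, 1` at `π/2`: no superposition
arises, so a Pauli string stays one up to sign. -/
theorem evolve_discrete (b : ι → Bool) (l : List (Gate ι n)) (α : PauliIndex n) :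
    evolve (fun k => trig (angle b k)) l (pauliString α) = pauliString (discretePath b l α) ∨
      evolve (fun k => trig (angle b k)) l (pauliString α) =
        -pauliString (discretePath b l α) := by
  induction l generalizing α with
  | nil => exact Or.inl rfl
  | cons g l ih =>
    have aux : ∀ {A : QOp n} {β : PauliIndex n}, A = pauliString β ∨ A = -pauliString β →
        evolve (fun k => trig (angle b k)) l A = pauliString (discretePath b l β) ∨
        evolve (fun k => trig (angle b k)) l A = -pauliString (discretePath b l β) := by
      intro A β hA
      rcases hA with rfl | rfl
      · exact ih β
      · rw [map_neg, neg_inj, neg_eq_iff_eq_neg]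
        exact (ih β).symm
    cases g with
    | fixed W hW => exact aux (hW.cliffordIndex_spec α)
    | rot k G =>
      refine aux ?_
      have h0 := rotComponent_zero_apply G α
      have h1 := rotComponent_one_apply G α
      simp only [Fin.sum_univ_three, trig, angle]
      by_cases hb : b k <;> by_cases hc : α.Commutes G
      · simp [hb, h0, hc, rotComponent_two_of_commutes hc]
      · simpa [hb, h0, hc] using rotComponent_two_of_not_commutes hc
      · simp [hb, hc, h0, h1]
      · simp [hb, hc, h0, h1]

end Gate

/-! ### Trigonometric polynomials of degree at most one in every variable -/

open MeasureTheory

instance : IsProbabilityMeasure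
    (ProbabilityTheory.cond volume (Set.Icc (-Real.pi) Real.pi)) :=
  ProbabilityTheory.cond_isProbabilityMeasure_of_finite
    (by simp [Real.volume_Icc, Real.pi_pos]) (by simp [Real.volume_Icc])

instance (ι : Type) [Fintype ι] : IsProbabilityMeasure (uniformParams ι) :=
  inferInstanceAs (IsProbabilityMeasure (Measure.pi _))

/-- The squared norms of `1`, `cos`, `sin`. -/
noncomputable def trigWeight : Fin 3 → ℝ := ![1, 1 / 2, 1 / 2]

theorem trigWeight_nonneg (j : Fin 3) : 0 ≤ trigWeight j := by
  fin_cases j <;> norm_num [trigWeight]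

theorem continuous_trig (j : Fin 3) : Continuous fun t => trig t j := by
  fin_cases j
  exacts [continuous_const, Real.continuous_cos, Real.continuous_sin]

theorem abs_trig_le_one (t : ℝ) (j : Fin 3) : |trig t j| ≤ 1 := by
  fin_cases j
  exacts [by simp [trig], Real.abs_cos_le_one t, Real.abs_sin_le_one t]

theorem integral_cond_Icc (f : ℝ → ℝ) :
    ∫ t, f t ∂(ProbabilityTheory.cond volume (Set.Icc (-Real.pi) Real.pi)) =
      (2 * Real.pi)⁻¹ * ∫ t in (-Real.pi)..Real.pi, f t := by
  have h : (volume (Set.Icc (-Real.pi) Real.pi))⁻¹.toReal = (2 * Real.pi)⁻¹ := by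
    rw [Real.volume_Icc, ENNReal.toReal_inv, ENNReal.toReal_ofReal (by linarith [Real.pi_pos])]
    ring
  rw [ProbabilityTheory.cond, integral_smul_measure, h, smul_eq_mul,
    intervalIntegral.integral_of_le (by linarith [Real.pi_pos]), integral_Icc_eq_integral_Ioc]

theorem integral_trig_mul_trig (i j : Fin 3) :
    ∫ t, trig t i * trig t j ∂(ProbabilityTheory.cond volume (Set.Icc (-Real.pi) Real.pi)) =
      if i = j then trigWeight i else 0 := by
  have hpi := Real.pi_ne_zero
  have h1 : (∫ t in (-Real.pi)..Real.pi, Real.cos t * Real.cos t) = Real.pi := by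
    simp only [← sq, integral_cos_sq]; simp
  have h2 : (∫ t in (-Real.pi)..Real.pi, Real.sin t * Real.sin t) = Real.pi := by
    simp only [← sq, integral_sin_sq]; simp
  have h3 : (∫ t in (-Real.pi)..Real.pi, Real.sin t * Real.cos t) = 0 := by
    rw [integral_sin_mul_cos₁]; simp
  have h4 : (∫ t in (-Real.pi)..Real.pi, Real.cos t * Real.sin t) = 0 := by
    simp only [mul_comm (Real.cos _)]; exact h3
  rw [integral_cond_Icc]
  fin_cases i <;> fin_cases j <;> simp [trig, trigWeight, h1, h2, h3, h4] <;>
    field_simp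
  norm_num

/-- The exchange of `cos` and `sin`. -/
def trigSwap : Fin 3 → Fin 3 := ![0, 2, 1]

theorem trigSwap_trigSwap (j : Fin 3) : trigSwap (trigSwap j) = j := by
  revert j; decide

/-- Exchange of `cos` and `sin` in the variable `k`. -/
def swapEquiv {ι : Type} [DecidableEq ι] (k : ι) : (ι → Fin 3) ≃ (ι → Fin 3) :=
  Function.Involutive.toPerm (fun s => Function.update s k (trigSwap (s k))) fun s => by
    simp [trigSwap_trigSwap]

theorem swapEquiv_apply {ι : Type} [DecidableEq ι] (k : ι) (s : ι → Fin 3) :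
    swapEquiv k s = Function.update s k (trigSwap (s k)) := rfl

section

variable {ι : Type} [Fintype ι]

/-- A product of functions `1`, `cos`, `sin` of the individual parameters. -/
noncomputable def trigMonomial (s : ι → Fin 3) (θ : ι → ℝ) : ℝ := ∏ k, trig (θ k) (s k)

/-- The squared norm of a trigonometric monomial. -/
noncomputable def monomialWeight (s : ι → Fin 3) : ℝ := ∏ k, trigWeight (s k)

theorem monomialWeight_nonneg (s : ι → Fin 3) : 0 ≤ monomialWeight s :=
  Finset.prod_nonneg fun _ _ => trigWeight_nonneg _

theorem monomialWeight_zero : monomialWeight (fun _ : ι => 0) = 1 := by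
  simp [monomialWeight, trigWeight]

theorem continuous_trigMonomial (s : ι → Fin 3) : Continuous (trigMonomial s) :=
  continuous_finsetProd _ fun k _ => (continuous_trig (s k)).comp (continuous_apply k)

theorem abs_trigMonomial_le_one (s : ι → Fin 3) (θ : ι → ℝ) : |trigMonomial s θ| ≤ 1 := by
  rw [trigMonomial, Finset.abs_prod]
  exact Finset.prod_le_one (fun _ _ => abs_nonneg _) fun _ _ => abs_trig_le_one _ _

theorem trigMonomial_zero (θ : ι → ℝ) : trigMonomial (fun _ => 0) θ = 1 := by
  simp [trigMonomial, trig]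

theorem integral_trigMonomial_mul (s s' : ι → Fin 3) :
    ∫ θ, trigMonomial s θ * trigMonomial s' θ ∂(uniformParams ι) =
      if s = s' then monomialWeight s else 0 := by
  simp only [trigMonomial, ← Finset.prod_mul_distrib, uniformParams]
  rw [integral_fintype_prod_eq_prod (fun k t => trig t (s k) * trig t (s' k))]
  simp only [integral_trig_mul_trig, Finset.prod_ite_zero, Finset.mem_univ, true_implies,
    funext_iff, monomialWeight]

theorem memLp_trigMonomial (s : ι → Fin 3) : MemLp (trigMonomial s) 2 (uniformParams ι) :=
  MemLp.of_bound (continuous_trigMonomial s).aestronglyMeasurable 1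
    (Filter.Eventually.of_forall fun θ => abs_trigMonomial_le_one s θ)

variable [DecidableEq ι]

/-- The trigonometric polynomial with coefficients `a`. -/
noncomputable def trigSum (a : (ι → Fin 3) → ℝ) (θ : ι → ℝ) : ℝ := ∑ s, a s * trigMonomial s θ

theorem memLp_trigSum (a : (ι → Fin 3) → ℝ) : MemLp (trigSum a) 2 (uniformParams ι) :=
  memLp_finsetSum _ fun s _ => (memLp_trigMonomial s).const_mul (a s)

theorem integral_trigSum_mul (a b : (ι → Fin 3) → ℝ) :
    ∫ θ, trigSum a θ * trigSum b θ ∂(uniformParams ι) = ∑ s, a s * b s * monomialWeight s := by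
  simp only [trigSum, Finset.sum_mul_sum]
  have hint : ∀ s s' : ι → Fin 3, Integrable
      (fun θ => a s * trigMonomial s θ * (b s' * trigMonomial s' θ)) (uniformParams ι) :=
    fun s s' => ((memLp_trigMonomial s).const_mul (a s)).integrable_mul
      ((memLp_trigMonomial s').const_mul (b s'))
  rw [integral_finsetSum _ fun s _ => integrable_finsetSum _ fun s' _ => hint s s']
  refine Finset.sum_congr rfl fun s _ => ?_
  rw [integral_finsetSum _ fun s' _ => hint s s']
  simp only [mul_mul_mul_comm, integral_const_mul, integral_trigMonomial_mul, mul_ite, mul_zero,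
    Finset.sum_ite_eq, Finset.mem_univ, if_true]

theorem integral_trigSum (a : (ι → Fin 3) → ℝ) :
    ∫ θ, trigSum a θ ∂(uniformParams ι) = a fun _ => 0 := by
  -- The mean is the inner product with the constant monomial.
  have h := integral_trigSum_mul a (Pi.single (fun _ => 0) 1)
  have h1 : trigSum (Pi.single (fun _ : ι => (0 : Fin 3)) 1) = fun _ => 1 := by
    funext θ
    rw [trigSum, Finset.sum_eq_single (fun _ => 0)]
    · simp [trigMonomial_zero]
    · intro s _ hs
      rw [Pi.single_eq_of_ne hs, zero_mul]
    · simp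
  rw [h1] at h
  simp only [mul_one] at h
  rw [h, Finset.sum_eq_single (fun _ => 0)]
  · simp [monomialWeight_zero]
  · intro s _ hs
    rw [Pi.single_eq_of_ne hs, mul_zero, zero_mul]
  · simp

theorem paramVar_trigSum (a : (ι → Fin 3) → ℝ) :
    paramVar (trigSum a) = ∑ s, a s ^ 2 * monomialWeight s - a (fun _ => 0) ^ 2 := by
  rw [paramVar, ProbabilityTheory.variance_eq_sub (memLp_trigSum a), integral_trigSum]
  congr 1
  simp only [Pi.pow_apply, sq]
  exact integral_trigSum_mul a a

theorem discreteMean_eq (f : (ι → ℝ) → ℝ) :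
    discreteMean f = (∑ b : ι → Bool, f (Gate.angle b)) / 2 ^ Fintype.card ι := rfl

theorem sum_trigMonomial_mul (s s' : ι → Fin 3) :
    ∑ b : ι → Bool, trigMonomial s (Gate.angle b) * trigMonomial s' (Gate.angle b) =
      ∏ k, ∑ c : Bool, trig (if c then Real.pi / 2 else 0) (s k) *
        trig (if c then Real.pi / 2 else 0) (s' k) := by
  simp only [Finset.prod_univ_sum, Fintype.piFinset_univ, trigMonomial, Gate.angle,
    Finset.prod_mul_distrib]

/-- On `{0, π/2}` the squared norms of `1, cos, sin` are still `1, 1/2, 1/2`, but `1` is no longer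
orthogonal to `cos` and `sin`. Only `cos · sin = 0` remains, and `ha` removes the pairs of monomials
in which no `cos` meets a `sin`. -/
theorem discreteMean_trigSum_sq (a : (ι → Fin 3) → ℝ)
    (ha : ∀ s s', s ≠ s' → (∀ k, s k = s' k ∨ s k = 0 ∨ s' k = 0) → a s = 0 ∨ a s' = 0) :
    discreteMean (fun θ => trigSum a θ ^ 2) = ∑ s, a s ^ 2 * monomialWeight s := by
  rw [discreteMean_eq, div_eq_iff (by positivity), Finset.sum_mul]
  simp only [trigSum, sq, Finset.sum_mul_sum, mul_mul_mul_comm]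
  rw [Finset.sum_comm]
  refine Finset.sum_congr rfl fun s _ => ?_
  rw [Finset.sum_comm, Finset.sum_eq_single s]
  · rw [← Finset.mul_sum, sum_trigMonomial_mul, mul_assoc (a s * a s)]
    congr 1
    -- One factor `2` per parameter: the sum over its two angles is twice the mean.
    rw [monomialWeight, ← Finset.card_univ, ← Finset.prod_const, ← Finset.prod_mul_distrib]
    refine Finset.prod_congr rfl fun k _ => ?_
    generalize s k = j
    fin_cases j <;> simp [trig, trigWeight]
  · intro s' _ hne
    rw [← Finset.mul_sum, sum_trigMonomial_mul]
    by_cases h : ∀ k, s k = s' k ∨ s k = 0 ∨ s' k = 0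
    · rcases ha s s' (Ne.symm hne) h with h1 | h1 <;> simp [h1]
    · push Not at h
      obtain ⟨k, h1, h2, h3⟩ := h
      rw [Finset.prod_eq_zero (Finset.mem_univ k), mul_zero]
      generalize s k = i at *
      generalize s' k = j at *
      fin_cases i <;> fin_cases j <;> simp_all [trig]
  · simp

/-- The factors of the derivatives of `1`, `cos`, `sin`. -/
def trigSign : Fin 3 → ℝ := ![0, -1, 1]

/-- The coefficients of a partial derivative of a trigonometric polynomial. -/
def derivCoeff (k : ι) (a : (ι → Fin 3) → ℝ) (s : ι → Fin 3) : ℝ :=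
  a (Function.update s k (trigSwap (s k))) * trigSign (trigSwap (s k))

theorem hasDerivAt_trig (t : ℝ) (j : Fin 3) :
    HasDerivAt (fun t => trig t j) (trigSign j * trig t (trigSwap j)) t := by
  fin_cases j
  · simpa [trig, trigSign] using hasDerivAt_const t (1 : ℝ)
  · simpa [trig, trigSign, trigSwap] using Real.hasDerivAt_cos t
  · simpa [trig, trigSign, trigSwap] using Real.hasDerivAt_sin t

theorem monomialWeight_swapEquiv (k : ι) (s : ι → Fin 3) :
    monomialWeight (swapEquiv k s) = monomialWeight s := by
  refine Finset.prod_congr rfl fun i _ => ?_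
  rw [swapEquiv_apply]
  by_cases h : i = k
  · subst h
    rw [Function.update_self]
    generalize s i = j
    fin_cases j <;> rfl
  · rw [Function.update_of_ne h]

theorem partialDeriv_trigSum (k : ι) (a : (ι → Fin 3) → ℝ) :
    partialDeriv k (trigSum a) = trigSum (derivCoeff k a) := by
  funext θ
  have hmono : ∀ (s : ι → Fin 3) (t : ℝ), trigMonomial s (Function.update θ k t) =
      trig t (s k) * ∏ i ∈ Finset.univ.erase k, trig (θ i) (s i) := by
    intro s t
    rw [trigMonomial, ← Finset.mul_prod_erase _ _ (Finset.mem_univ k), Function.update_self]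
    congr 1
    exact Finset.prod_congr rfl fun i hi => by
      rw [Function.update_of_ne (Finset.ne_of_mem_erase hi)]
  have hd : HasDerivAt (fun t => trigSum a (Function.update θ k t))
      (∑ s, a s * (trigSign (s k) * trig (θ k) (trigSwap (s k)) *
        ∏ i ∈ Finset.univ.erase k, trig (θ i) (s i))) (θ k) := by
    simp only [trigSum, hmono]
    exact HasDerivAt.fun_sum fun s _ => ((hasDerivAt_trig _ _).mul_const _).const_mul _
  -- Differentiation exchanges `cos` and `sin` in the variable `k`, hence the reindexing by
  -- `swapEquiv k`.
  rw [partialDeriv, hd.deriv, trigSum, ← (swapEquiv k).sum_comp]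
  refine Finset.sum_congr rfl fun s _ => ?_
  simp only [swapEquiv_apply, derivCoeff, Function.update_self, trigSwap_trigSwap]
  have h := hmono s (θ k)
  rw [Function.update_eq_self] at h
  rw [h, Finset.prod_congr rfl (g := fun i => trig (θ i) (s i)) fun i hi => by
      rw [Function.update_of_ne (Finset.ne_of_mem_erase hi)]]
  ring

/-- The derivative in `k` kills the monomials constant in `k` and permutes the others up to sign,
preserving norms. Its own constant coefficient is zero, so nothing is subtracted for the mean. -/
theorem paramVar_partialDeriv_trigSum (k : ι) (a : (ι → Fin 3) → ℝ) :
    paramVar (partialDeriv k (trigSum a)) =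
      ∑ s, if s k = 0 then 0 else a s ^ 2 * monomialWeight s := by
  rw [partialDeriv_trigSum, paramVar_trigSum]
  have h0 : derivCoeff k a (fun _ => 0) = 0 := by simp [derivCoeff, trigSign, trigSwap]
  rw [h0, ← (swapEquiv k).sum_comp]
  simp only [ne_eq, OfNat.ofNat_ne_zero, not_false_eq_true, zero_pow, sub_zero]
  refine Finset.sum_congr rfl fun s _ => ?_
  rw [monomialWeight_swapEquiv]
  simp only [derivCoeff, swapEquiv_apply, Function.update_self, trigSwap_trigSwap,
    Function.update_idem, Function.update_eq_self, mul_pow]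
  generalize s k = j
  fin_cases j <;> simp [trigSign]

/-- The square of a sum with at most one nonzero term. -/
theorem sq_sum_eq_sum_sq_of_disjoint {κ : Type} [Fintype κ] (c x : κ → ℝ)
    (h : ∀ i j, i ≠ j → x i = 0 ∨ x j = 0) :
    (∑ i, c i * x i) ^ 2 = ∑ i, c i ^ 2 * x i ^ 2 := by
  classical
  rw [sq, Finset.sum_mul_sum]
  refine Finset.sum_congr rfl fun i _ => ?_
  rw [Finset.sum_eq_single i]
  · ring
  · intro j _ hj
    rcases h j i hj with h1 | h1 <;> simp [h1]
  · simp

end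

/-! ### Layers of single-qubit rotations -/

theorem PauliIndex.commutes_single {n : ℕ} (α : PauliIndex n) (i : Fin n) (m : Fin 4) :
    α.Commutes (Pi.single i m) ↔ commSign (α i) m = 1 := by
  rw [PauliIndex.Commutes, Fintype.prod_eq_single i, Pi.single_eq_same]
  intro j hj
  rw [Pi.single_eq_of_ne hj]
  simp [commSign]

theorem mulIndex_zero (a : Fin 4) : mulIndex a 0 = a := by
  revert a; decide

theorem PauliIndex.mul_single {n : ℕ} (α : PauliIndex n) (i : Fin n) (m : Fin 4) :
    α.mul (Pi.single i m) = Function.update α i (mulIndex (α i) m) := by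
  funext j
  by_cases h : j = i
  · subst h; simp [PauliIndex.mul]
  · simp [PauliIndex.mul, h, mulIndex_zero]

/-- The index of a single-qubit Pauli matrix after a rotation by `0` or `π/2` about `σ_m`. -/
def rotIndex (m : Fin 4) (c : Bool) (a : Fin 4) : Fin 4 :=
  if c ∧ commSign a m ≠ 1 then mulIndex a m else a

namespace Gate

variable {ι : Type} {n : ℕ}

/-- Single-qubit rotations generated by `σ_{m i}` on the qubits `i` of a list. -/
def layer (f : Fin n → ι) (m : PauliIndex n) (is : List (Fin n)) : List (Gate ι n) :=
  is.map fun i => rot (f i) (Pi.single i (m i))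

theorem params_layer (f : Fin n → ι) (m : PauliIndex n) (is : List (Fin n)) :
    params (layer f m is) = is.map f := by
  induction is with
  | nil => rfl
  | cons i is ih => simpa [layer, params] using ih

/-- The gates of a layer touch different qubits, so each one still sees the original `α i`, and `s
(f i)` records its commutation with `σ_{m i}`. -/
theorem path_layer {s : ι → Fin 3} {f : Fin n → ι} {m : PauliIndex n} {is : List (Fin n)}
    (his : is.Nodup) {α β : PauliIndex n} (h : path s (layer f m is) α = some β) :
    (∀ i ∈ is, s (f i) = 0 ↔ commSign (α i) (m i) = 1) ∧
      ∀ j, β j = if j ∈ is ∧ s (f j) = 2 then mulIndex (α j) (m j) else α j := by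
  induction is generalizing α with
  | nil =>
    rw [layer, List.map_nil, path, Option.some_inj] at h
    simp [h]
  | cons i is ih =>
    rw [List.nodup_cons] at his
    rw [layer, List.map_cons] at h
    obtain ⟨h1, h2⟩ := path_rot_eq_some h
    obtain ⟨h3, h4⟩ := ih his.2 h2
    rw [PauliIndex.commutes_single] at h1
    rw [PauliIndex.mul_single] at h3 h4
    have hne : ∀ j ∈ is, j ≠ i := fun j hj hji => his.1 (hji ▸ hj)
    refine ⟨?_, fun j => ?_⟩
    · simp only [List.mem_cons, forall_eq_or_imp]
      refine ⟨h1, fun j hj => ?_⟩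
      rw [h3 j hj]
      split_ifs
      · rw [Function.update_of_ne (hne j hj)]
      · rfl
    · rw [h4 j]
      by_cases hj : j = i
      · subst hj
        simp only [his.1, false_and, if_false, List.mem_cons_self, true_and]
        split_ifs <;> simp
      · simp only [List.mem_cons, hj, false_or]
        split_ifs <;> simp [hj]

theorem discretePath_layer (b : ι → Bool) (f : Fin n → ι) (m : PauliIndex n)
    {is : List (Fin n)} (his : is.Nodup) (α : PauliIndex n) (j : Fin n) :
    discretePath b (layer f m is) α j =
      if j ∈ is then rotIndex (m j) (b (f j)) (α j) else α j := by
  induction is generalizing α with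
  | nil => rfl
  | cons i is ih =>
    rw [List.nodup_cons] at his
    rw [layer, List.map_cons, discretePath]
    refine (ih his.2 _).trans ?_
    simp only [PauliIndex.commutes_single, PauliIndex.mul_single]
    by_cases hj : j = i
    · subst hj
      simp only [his.1, if_false, List.mem_cons_self, if_true, rotIndex]
      split_ifs <;> simp
    · simp only [List.mem_cons, hj, false_or]
      split_ifs <;> simp [hj]

end Gate

/-- Two orthogonal single-qubit rotations separate the Pauli matrices. -/
theorem eq_of_layers (μ ν a a' : Fin 4) (s t : Fin 3) (hμ : μ ≠ 0) (hν : ν ≠ 0) (hμν : μ ≠ ν)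
    (h1 : s = 0 ↔ commSign a μ = 1) (h2 : s = 0 ↔ commSign a' μ = 1)
    (h3 : t = 0 ↔ commSign (if s = 2 then mulIndex a μ else a) ν = 1)
    (h4 : t = 0 ↔ commSign (if s = 2 then mulIndex a' μ else a') ν = 1) : a = a' := by
  -- If `s = 0`, both indices lie in `{0, μ}`; otherwise both lie in the complement of this set,
  -- where multiplication by `σ_μ` exchanges the two elements. In either pair exactly one element
  -- commutes with `σ_ν`, which `t` detects.
  revert μ ν a a' s t
  decide +kernel

/-! ### The circuit as a list of gates, and its loss as a trigonometric polynomial. -/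

namespace PauliCircuit

variable {n : ℕ} (C : PauliCircuit n)

/-- The gates after the two initial layers, the last gate first. -/
def tailGates : List (Gate C.Param n) :=
  (List.ofFn fun k => Gate.fixed (C.W k) (C.clifford k) ::
    (List.ofFn fun l => Gate.rot (.inr (.inr ⟨k, l⟩)) (C.P k l)).reverse).reverse.flatten

/-- The gates of the two initial layers, the last gate first. -/
def initialGates : List (Gate C.Param n) :=
  Gate.layer (fun i => .inr (.inl i)) C.μ (List.finRange n) ++
    Gate.layer (fun i => .inl i) C.ν (List.finRange n)

/-- All gates of the circuit, the last gate first. -/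
def gates : List (Gate C.Param n) := C.tailGates ++ C.initialGates

theorem prod_tailGates (θ : C.Param → ℝ) : (C.tailGates.map (Gate.mat θ)).prod = C.tail θ := by
  simp only [tailGates, tail, rotations, List.map_flatten, List.prod_flatten, List.map_reverse,
    List.map_ofFn, Function.comp_def, List.map_cons, List.prod_cons, Gate.mat]

theorem prod_gates (θ : C.Param → ℝ) : (C.gates.map (Gate.mat θ)).prod = C.unitary θ := by
  simp only [gates, initialGates, List.map_append, List.prod_append, prod_tailGates, unitary,
    firstLayer, secondLayer, Gate.layer, List.ofFn_eq_map, List.map_map, Function.comp_def,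
    Gate.mat, Matrix.mul_assoc]

theorem params_tailGates : Gate.params C.tailGates =
    ((List.ofFn fun k =>
      (List.ofFn fun l => (.inr (.inr ⟨k, l⟩) : C.Param)).reverse).reverse).flatten := by
  have h1 : ∀ L : List (List (Gate C.Param n)),
      Gate.params L.flatten = (L.map Gate.params).flatten := by
    intro L
    induction L with
    | nil => rfl
    | cons l L ih => rw [List.flatten_cons, Gate.params_append, ih]; rfl
  have h2 : ∀ L : List (C.Param × PauliIndex n),
      Gate.params (L.map fun x => Gate.rot x.1 x.2) = L.map Prod.fst := by
    intro L
    induction L with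
    | nil => rfl
    | cons l L ih => simp [Gate.params, ih]
  have h3 : ∀ k, Gate.params (Gate.fixed (C.W k) (C.clifford k) ::
      (List.ofFn fun l => (Gate.rot (.inr (.inr ⟨k, l⟩)) (C.P k l) : Gate C.Param n)).reverse) =
      (List.ofFn fun l => (.inr (.inr ⟨k, l⟩) : C.Param)).reverse := by
    intro k
    have h := h2 (List.ofFn fun l => ((.inr (.inr ⟨k, l⟩) : C.Param), C.P k l)).reverse
    simp only [List.map_reverse, List.map_ofFn, Function.comp_def] at h
    exact h
  rw [tailGates, h1, List.map_reverse, List.map_ofFn]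
  simp only [Function.comp_def, h3]

theorem mem_params_tailGates (k : C.Param) :
    k ∈ Gate.params C.tailGates ↔ ∃ x, k = .inr (.inr x) := by
  rw [params_tailGates]
  simp only [List.mem_flatten, List.mem_reverse, List.mem_ofFn]
  constructor
  · rintro ⟨_, ⟨i, rfl⟩, h⟩
    simp only [List.mem_reverse, List.mem_ofFn] at h
    obtain ⟨l, rfl⟩ := h
    exact ⟨_, rfl⟩
  · rintro ⟨⟨i, l⟩, rfl⟩
    exact ⟨_, ⟨i, rfl⟩, by simp⟩

theorem nodup_params_tailGates : (Gate.params C.tailGates).Nodup := by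
  rw [params_tailGates, List.nodup_flatten]
  constructor
  · intro l hl
    simp only [List.mem_reverse, List.mem_ofFn] at hl
    obtain ⟨k, rfl⟩ := hl
    rw [List.nodup_reverse, List.nodup_ofFn]
    intro a b h
    simpa using h
  · rw [List.pairwise_reverse, List.pairwise_ofFn]
    intro i j hij x hx hy
    simp only [List.mem_reverse, List.mem_ofFn] at hx hy
    obtain ⟨a, rfl⟩ := hx
    obtain ⟨b, hb⟩ := hy
    simp only [Sum.inr.injEq, Sigma.mk.injEq] at hb
    exact hij.ne hb.1

theorem params_gates : Gate.params C.gates = Gate.params C.tailGates ++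
    ((List.finRange n).map (fun i => .inr (.inl i)) ++ (List.finRange n).map fun i => .inl i) := by
  rw [gates, initialGates, Gate.params_append, Gate.params_append, Gate.params_layer,
    Gate.params_layer]

theorem mem_params_gates (k : C.Param) : k ∈ Gate.params C.gates := by
  rw [params_gates, List.mem_append, mem_params_tailGates]
  rcases k with i | i | x <;> simp

theorem nodup_params_gates : (Gate.params C.gates).Nodup := by
  rw [params_gates, List.nodup_append', List.nodup_append']
  refine ⟨C.nodup_params_tailGates, ⟨?_, ?_, ?_⟩, ?_⟩
  · exact (List.nodup_finRange n).map fun a b h => by simpa using h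
  · exact (List.nodup_finRange n).map fun a b h => by simpa using h
  · intro x hx hy
    simp only [List.mem_map, List.mem_finRange, true_and] at hx hy
    obtain ⟨i, rfl⟩ := hx
    simp at hy
  · intro x hx hy
    obtain ⟨y, rfl⟩ := (C.mem_params_tailGates x).1 hx
    simp at hy

/-- The monomial selecting a Pauli string determines this Pauli string. -/
theorem path_gates_injective {s : C.Param → Fin 3} {α β : PauliIndex n}
    (hα : Gate.path s C.gates α ≠ none) (hβ : Gate.path s C.gates β ≠ none) : α = β := by
  -- `δ` is the string that arrives at the two layers; the conditions say what `s` records about it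
  -- there.
  have aux : ∀ γ : PauliIndex n, Gate.path s C.gates γ ≠ none → ∃ δ,
      Gate.path s C.tailGates γ = some δ ∧ ∀ i,
        (s (.inr (.inl i)) = 0 ↔ commSign (δ i) (C.μ i) = 1) ∧
        (s (.inl i) = 0 ↔ commSign (if s (.inr (.inl i)) = 2 then mulIndex (δ i) (C.μ i)
          else δ i) (C.ν i) = 1) := by
    intro γ hγ
    obtain ⟨ε, h⟩ := Option.ne_none_iff_exists'.1 hγ
    rw [gates, Gate.path_append, Option.bind_eq_some_iff] at h
    obtain ⟨δ, h1, h⟩ := h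
    rw [initialGates, Gate.path_append, Option.bind_eq_some_iff] at h
    obtain ⟨η, h2, h3⟩ := h
    obtain ⟨h4, h5⟩ := Gate.path_layer (List.nodup_finRange n) h2
    obtain ⟨h6, _⟩ := Gate.path_layer (List.nodup_finRange n) h3
    refine ⟨δ, h1, fun i => ⟨h4 i (List.mem_finRange i), ?_⟩⟩
    have h7 := h6 i (List.mem_finRange i)
    simpa only [h5, List.mem_finRange, true_and] using h7
  obtain ⟨γ, h1, h2⟩ := aux α hα
  obtain ⟨γ', h1', h2'⟩ := aux β hβ
  have : γ = γ' := funext fun i => eq_of_layers (C.μ i) (C.ν i) _ _ _ _ (C.μ_ne_zero i)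
    (C.ν_ne_zero i) (C.μ_ne_ν i) (h2 i).1 (h2' i).1 (h2 i).2 (h2' i).2
  subst this
  exact Gate.path_injective h1 h1'

theorem discretePath_initialGates (b : C.Param → Bool) (γ : PauliIndex n) :
    Gate.discretePath b C.initialGates γ = fun i =>
      rotIndex (C.ν i) (b (.inl i)) (rotIndex (C.μ i) (b (.inr (.inl i))) (γ i)) := by
  funext i
  rw [initialGates, Gate.discretePath_append,
    Gate.discretePath_layer _ _ _ (List.nodup_finRange n), if_pos (List.mem_finRange i),
    Gate.discretePath_layer _ _ _ (List.nodup_finRange n), if_pos (List.mem_finRange i)]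

/-- The coefficients of the loss as a trigonometric polynomial. -/
noncomputable def lossCoeff (ρ H : QOp n) (s : C.Param → Fin 3) : ℝ :=
  (ρ * Gate.coeff s C.gates H).trace.re

theorem loss_eq_trace (ρ H : QOp n) (θ : C.Param → ℝ) :
    C.loss ρ H θ = (ρ * ((C.unitary θ)ᴴ * H * C.unitary θ)).trace.re := by
  rw [loss, Matrix.mul_assoc, Matrix.mul_assoc, Matrix.trace_mul_comm]
  simp only [Matrix.mul_assoc]

theorem loss_eq_trigSum (ρ H : QOp n) : C.loss ρ H = trigSum (C.lossCoeff ρ H) := by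
  funext θ
  rw [loss_eq_trace, ← prod_gates, ← Gate.evolve_trig,
    ← Gate.sum_coeff _ _ C.nodup_params_gates fun k hk => absurd (C.mem_params_gates k) hk]
  simp only [Finset.mul_sum, Matrix.mul_smul, Matrix.trace_sum, Matrix.trace_smul, trigSum,
    Complex.re_sum, smul_eq_mul, Complex.re_ofReal_mul, lossCoeff, trigMonomial]
  exact Finset.sum_congr rfl fun s _ => mul_comm _ _

theorem lossCoeff_observable (ρ : QOp n) (c : PauliIndex n → ℝ) (s : C.Param → Fin 3) :
    C.lossCoeff ρ (observable c) s = ∑ α, c α * C.lossCoeff ρ (pauliString α) s := by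
  simp only [lossCoeff, observable, map_sum, map_smul, Finset.mul_sum, Matrix.mul_smul,
    Matrix.trace_sum, Matrix.trace_smul, Complex.re_sum, smul_eq_mul, Complex.re_ofReal_mul]

theorem lossCoeff_eq_zero (ρ : QOp n) {α : PauliIndex n} {s : C.Param → Fin 3}
    (h : Gate.path s C.gates α = none) : C.lossCoeff ρ (pauliString α) s = 0 := by
  rw [lossCoeff, Gate.coeff_of_path_eq_none h, Matrix.mul_zero, Matrix.trace_zero, Complex.zero_re]

/-- No monomial occurs for two Pauli terms, so cross terms disappear coefficient by coefficient. -/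
theorem lossCoeff_eq_zero_or (ρ : QOp n) {α β : PauliIndex n} (h : α ≠ β)
    (s : C.Param → Fin 3) :
    C.lossCoeff ρ (pauliString α) s = 0 ∨ C.lossCoeff ρ (pauliString β) s = 0 := by
  by_contra! hc
  exact h (C.path_gates_injective (fun h1 => hc.1 (C.lossCoeff_eq_zero ρ h1))
    fun h1 => hc.2 (C.lossCoeff_eq_zero ρ h1))

theorem lossCoeff_observable_sq (ρ : QOp n) (c : PauliIndex n → ℝ) (s : C.Param → Fin 3) :
    C.lossCoeff ρ (observable c) s ^ 2 =
      ∑ α, c α ^ 2 * C.lossCoeff ρ (pauliString α) s ^ 2 := by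
  rw [lossCoeff_observable]
  exact sq_sum_eq_sum_sq_of_disjoint _ _ fun _ _ h => C.lossCoeff_eq_zero_or ρ h s

/-- The constant monomial already determines the identity as its starting string. -/
theorem path_zero_eq_none {α : PauliIndex n} (hα : α ≠ 0) :
    Gate.path (fun _ => 0) C.gates α = none := by
  by_contra h
  exact hα (C.path_gates_injective h (by rw [Gate.path_zero]; simp))

theorem paramVar_loss_observable (ρ : QOp n) (c : PauliIndex n → ℝ) :
    paramVar (C.loss ρ (observable c)) = ∑ α, c α ^ 2 * paramVar (C.loss ρ (pauliString α)) := by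
  simp only [loss_eq_trigSum, paramVar_trigSum, lossCoeff_observable_sq, mul_sub,
    Finset.sum_sub_distrib, Finset.sum_mul, Finset.mul_sum]
  rw [Finset.sum_comm]
  simp only [mul_assoc]

theorem paramVar_partialDeriv_loss_observable (ρ : QOp n) (c : PauliIndex n → ℝ) (k : C.Param) :
    paramVar (partialDeriv k (C.loss ρ (observable c))) =
      ∑ α, c α ^ 2 * paramVar (partialDeriv k (C.loss ρ (pauliString α))) := by
  simp only [loss_eq_trigSum, paramVar_partialDeriv_trigSum, lossCoeff_observable_sq,
    Finset.sum_mul, Finset.mul_sum]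
  rw [Finset.sum_comm]
  refine Finset.sum_congr rfl fun s _ => ?_
  split_ifs
  · simp
  · simp only [mul_assoc]

theorem paramVar_loss (ρ : QOp n) {α : PauliIndex n} (hα : α ≠ 0) :
    paramVar (C.loss ρ (pauliString α)) =
      ∑ s, C.lossCoeff ρ (pauliString α) s ^ 2 * monomialWeight s := by
  rw [loss_eq_trigSum, paramVar_trigSum, C.lossCoeff_eq_zero ρ (C.path_zero_eq_none hα)]
  simp

theorem paramVar_loss_eq_discreteMean (ρ : QOp n) {α : PauliIndex n} (hα : α ≠ 0) :
    paramVar (C.loss ρ (pauliString α)) =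
      discreteMean (fun θ => C.loss ρ (pauliString α) θ ^ 2) := by
  rw [paramVar_loss C ρ hα, loss_eq_trigSum, discreteMean_trigSum_sq]
  intro s s' hne hs
  have h : ∃ k ∈ Gate.params C.gates, s k ≠ s' k := by
    obtain ⟨k, hk⟩ := Function.ne_iff.1 hne
    exact ⟨k, C.mem_params_gates k, hk⟩
  exact (Gate.path_eq_none_or hs h α).imp (C.lossCoeff_eq_zero ρ) (C.lossCoeff_eq_zero ρ)

theorem paramVar_partialDeriv_le (ρ : QOp n) {α : PauliIndex n} (hα : α ≠ 0) (k : C.Param) :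
    paramVar (partialDeriv k (C.loss ρ (pauliString α))) ≤
      paramVar (C.loss ρ (pauliString α)) := by
  rw [paramVar_loss C ρ hα, loss_eq_trigSum, paramVar_partialDeriv_trigSum]
  refine Finset.sum_le_sum fun s _ => ?_
  split_ifs
  · exact mul_nonneg (sq_nonneg _) (monomialWeight_nonneg s)
  · exact le_rfl

/-- For the parameter contained in all selected monomials, differentiation loses no term of the
variance. -/
theorem exists_paramVar_partialDeriv_eq (ρ : QOp n) {α : PauliIndex n} (hα : α ≠ 0) :
    ∃ k, paramVar (partialDeriv k (C.loss ρ (pauliString α))) =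
      paramVar (C.loss ρ (pauliString α)) := by
  obtain ⟨k, hk⟩ := Gate.exists_param_of_path_zero (C.path_zero_eq_none hα)
  refine ⟨k, ?_⟩
  rw [paramVar_loss C ρ hα, loss_eq_trigSum, paramVar_partialDeriv_trigSum]
  refine Finset.sum_congr rfl fun s _ => ?_
  split_ifs with h
  · rw [C.lossCoeff_eq_zero ρ (hk s h)]; simp
  · rfl

/-- Variances are nonnegative, so the sup norm over the finitely many parameters is their maximum.
-/
theorem norm_paramVar_partialDeriv (ρ : QOp n) {α : PauliIndex n} (hα : α ≠ 0) :
    ‖fun k : C.Param => paramVar (partialDeriv k (C.loss ρ (pauliString α)))‖ =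
      paramVar (C.loss ρ (pauliString α)) := by
  have h0 : ∀ f : (C.Param → ℝ) → ℝ, 0 ≤ paramVar f := fun f =>
    ProbabilityTheory.variance_nonneg f _
  refine le_antisymm ?_ ?_
  · refine (pi_norm_le_iff_of_nonneg (h0 _)).2 fun k => ?_
    rw [Real.norm_of_nonneg (h0 _)]
    exact C.paramVar_partialDeriv_le ρ hα k
  · obtain ⟨k, hk⟩ := C.exists_paramVar_partialDeriv_eq ρ hα
    rw [← hk]
    have h := norm_le_pi_norm
      (fun k : C.Param => paramVar (partialDeriv k (C.loss ρ (pauliString α)))) k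
    rwa [Real.norm_of_nonneg (h0 _)] at h

end PauliCircuit

/-! ### Counting the paths through two orthogonal layers -/

/-- The number of choices of angles in `{0, π/2}` for rotations about `σ_ν` and `σ_μ` under which
`σ_g` evolves to `σ_a`. -/
def layerCount (μ ν g a : Fin 4) : ℕ :=
  ∑ p : Bool × Bool, if rotIndex ν p.1 (rotIndex μ p.2 g) = a then 1 else 0

/-- The single-qubit condition in the definition of `Λ(β)`. -/
def LayerAllowed (μ ν g a : Fin 4) : Prop :=
  (g = 0 → a = 0) ∧ (g = μ → a ≠ 0 ∧ a ≠ ν) ∧ (g ≠ 0 → g ≠ μ → a ≠ 0)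

instance (μ ν g a : Fin 4) : Decidable (LayerAllowed μ ν g a) :=
  inferInstanceAs (Decidable (_ ∧ _))

theorem layerCount_zero_index (μ ν a : Fin 4) :
    layerCount μ ν 0 a = if a = 0 then 4 else 0 := by
  revert μ ν a; decide +kernel

theorem layerCount_of_not_allowed (μ ν g a : Fin 4) (hμ : μ ≠ 0) (hν : ν ≠ 0) (h : μ ≠ ν)
    (ha : ¬ LayerAllowed μ ν g a) : layerCount μ ν g a = 0 := by
  revert μ ν g a; decide +kernel

/-- The rotation about `σ_μ` comes first in the Heisenberg picture. It fixes `σ_μ`, which then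
reaches each of the two axes other than `ν` twice; every other nontrivial `g` reaches `ν` twice and
the other two axes once each. -/
theorem layerCount_of_allowed (μ ν g a : Fin 4) (hμ : μ ≠ 0) (hν : ν ≠ 0) (h : μ ≠ ν)
    (hg : g ≠ 0) (ha : LayerAllowed μ ν g a) : 1 ≤ layerCount μ ν g a ∧ layerCount μ ν g a ≤ 2 := by
  revert μ ν g a; decide +kernel

theorem layerAllowed_of_ne (μ ν g a : Fin 4) (hg : g ≠ 0) (h0 : a ≠ 0) (h1 : a ≠ ν) :
    LayerAllowed μ ν g a :=
  ⟨fun h => absurd h hg, fun _ => ⟨h0, h1⟩, fun _ _ => h0⟩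

theorem layerCount_self (μ ν : Fin 4) (hμ : μ ≠ 0) (hν : ν ≠ 0) (h : μ ≠ ν) :
    layerCount μ ν ν ν = 2 ∧ layerCount μ ν ν μ = 1 ∧ layerCount μ ν ν 0 = 0 := by
  revert μ ν; decide +kernel

/-- Angle choices are grouped by the string they produce; independence of the qubits makes the size
of each fibre a product. -/
theorem sum_comp_rotIndex {n : ℕ} (μ ν γ : PauliIndex n) (F : PauliIndex n → ℝ) :
    ∑ p : Fin n → Bool × Bool, F (fun i => rotIndex (ν i) (p i).1 (rotIndex (μ i) (p i).2 (γ i))) =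
      ∑ l, F l * ∏ i, (layerCount (μ i) (ν i) (γ i) (l i) : ℝ) := by
  have h : ∀ l : PauliIndex n, ∏ i, (layerCount (μ i) (ν i) (γ i) (l i) : ℝ) =
      ∑ p : Fin n → Bool × Bool,
        if (fun i => rotIndex (ν i) (p i).1 (rotIndex (μ i) (p i).2 (γ i))) = l
          then 1 else 0 := by
    intro l
    simp only [layerCount, Nat.cast_sum, Nat.cast_ite, Nat.cast_one, Nat.cast_zero,
      Finset.prod_univ_sum, Fintype.piFinset_univ, Finset.prod_ite_zero, Finset.mem_univ,
      true_implies, Finset.prod_const_one, funext_iff]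
  simp only [h, Finset.mul_sum, mul_ite, mul_one, mul_zero]
  rw [Finset.sum_comm]
  simp

/-! ### Bloch vectors -/

/-- The Pauli coordinates of a single-qubit state. -/
noncomputable def bloch (r : Matrix (Fin 2) (Fin 2) ℂ) (a : Fin 4) : ℝ := (pauli a * r).trace.re

theorem ofReal_bloch {r : Matrix (Fin 2) (Fin 2) ℂ} (hr : IsMixedState r) (a : Fin 4) :
    (bloch r a : ℂ) = (pauli a * r).trace := by
  have h : star (pauli a * r).trace = (pauli a * r).trace := by
    rw [← Matrix.trace_conjTranspose, Matrix.conjTranspose_mul, conjTranspose_pauli,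
      hr.1.1, Matrix.trace_mul_comm]
  exact Complex.conj_eq_iff_re.1 h

theorem bloch_zero {r : Matrix (Fin 2) (Fin 2) ℂ} (hr : IsMixedState r) : bloch r 0 = 1 := by
  have : pauli 0 = 1 := rfl
  rw [bloch, this, Matrix.one_mul, hr.2, Complex.one_re]

theorem bloch_sq_le_one {r : Matrix (Fin 2) (Fin 2) ℂ} (hr : IsMixedState r) :
    bloch r 1 ^ 2 + bloch r 2 ^ 2 + bloch r 3 ^ 2 ≤ 1 := by
  have h1 : star (r 0 1) = r 1 0 := hr.1.1.apply 1 0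
  have h2 : star (r 0 0) = r 0 0 := hr.1.1.apply 0 0
  have h3 : star (r 1 1) = r 1 1 := hr.1.1.apply 1 1
  have h4 := hr.1.det_nonneg
  have h5 := hr.2
  rw [Matrix.det_fin_two, ← h1] at h4
  rw [Matrix.trace_fin_two] at h5
  have e2 := Complex.conj_eq_iff_im.1 h2
  have e3 := Complex.conj_eq_iff_im.1 h3
  have e4 := (Complex.le_def.1 h4).1
  have e5 := congrArg Complex.re h5
  simp only [Complex.sub_re, Complex.mul_re, Complex.star_def, Complex.conj_re, Complex.conj_im,
    e2, e3, Complex.zero_re, Complex.add_re, Complex.one_re] at e4 e5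
  simp only [bloch, pauli, Matrix.cons_val, Matrix.trace_fin_two, Matrix.mul_apply,
    Fin.sum_univ_two, Matrix.of_apply, ← h1, Complex.star_def]
  simp only [Complex.add_re, Complex.mul_re, Complex.neg_re, Complex.neg_im, Complex.I_re, Complex.I_im,
    Complex.conj_re, Complex.conj_im, Complex.one_re, Complex.one_im, Complex.zero_re,
    Complex.zero_im]
  -- The squared Bloch length is `(r₀₀ - r₁₁)² + 4|r₀₁|² = (tr r)² - 4 det r`, with trace one and
  -- nonnegative determinant.
  nlinarith [sq_nonneg ((r 0 0).re - (r 1 1).re)]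

theorem trace_pauliString_mul_tensor_sq {n : ℕ} {r : Fin n → Matrix (Fin 2) (Fin 2) ℂ}
    (hr : ∀ i, IsMixedState (r i)) (l : PauliIndex n) :
    (pauliString l * tensor r).trace.re ^ 2 = ∏ i, bloch (r i) (l i) ^ 2 := by
  rw [pauliString, tensor_mul, trace_tensor]
  simp only [← ofReal_bloch (hr _)]
  rw [← Complex.ofReal_prod, Complex.ofReal_re, Finset.prod_pow]

/-- The single-qubit factor of `Ω(ρ)` for a product state. -/
noncomputable def qubitOrthogonality (ν : Fin 4) (r : Matrix (Fin 2) (Fin 2) ℂ) : ℝ :=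
  ∑ a, if a ≠ 0 ∧ a ≠ ν then bloch r a ^ 2 else 0

theorem qubitOrthogonality_nonneg (ν : Fin 4) (r : Matrix (Fin 2) (Fin 2) ℂ) :
    0 ≤ qubitOrthogonality ν r :=
  Finset.sum_nonneg fun a _ => by split_ifs <;> positivity

theorem qubitOrthogonality_le_one (ν : Fin 4) {r : Matrix (Fin 2) (Fin 2) ℂ}
    (hr : IsMixedState r) : qubitOrthogonality ν r ≤ 1 := by
  refine le_trans (b := ∑ a, if a ≠ 0 then bloch r a ^ 2 else 0) ?_ ?_
  · refine Finset.sum_le_sum fun a _ => ?_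
    split_ifs with h1 h2 h2
    exacts [le_rfl, absurd h1.1 h2, sq_nonneg _, le_rfl]
  · have h := bloch_sq_le_one hr
    simpa [Fin.sum_univ_four] using h

theorem orthogonality_tensor {n : ℕ} (ν : PauliIndex n) {r : Fin n → Matrix (Fin 2) (Fin 2) ℂ}
    (hr : ∀ i, IsMixedState (r i)) :
    orthogonality ν (tensor r) = ∏ i, qubitOrthogonality (ν i) (r i) := by
  classical
  simp only [orthogonality, qubitOrthogonality, Finset.prod_univ_sum, Fintype.piFinset_univ,
    Finset.prod_ite_zero, Finset.mem_univ, true_implies, Finset.sum_filter,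
    trace_pauliString_mul_tensor_sq hr]

theorem sum_bloch_layerCount_zero (μ ν : Fin 4) {r : Matrix (Fin 2) (Fin 2) ℂ}
    (hr : IsMixedState r) : ∑ a, bloch r a ^ 2 * (layerCount μ ν 0 a : ℝ) = 4 := by
  simp [layerCount_zero_index, bloch_zero hr]

/-- For `g = 0` all four pairs contribute and the orthogonality factor is at most one. Otherwise
every axis other than `ν` is reached at least once, and `1 = 4 · 1/4`. -/
theorem le_sum_bloch_layerCount {μ ν : Fin 4} (hμ : μ ≠ 0) (hν : ν ≠ 0) (h : μ ≠ ν)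
    (g : Fin 4) {r : Matrix (Fin 2) (Fin 2) ℂ} (hr : IsMixedState r) :
    qubitOrthogonality ν r * (4 * if g = 0 then 1 else 1 / 4) ≤
      ∑ a, bloch r a ^ 2 * (layerCount μ ν g a : ℝ) := by
  by_cases hg : g = 0
  · subst hg
    rw [sum_bloch_layerCount_zero μ ν hr, if_pos rfl]
    linarith [qubitOrthogonality_le_one ν hr]
  · have h4 : (4 * (1 / 4) : ℝ) = 1 := by norm_num
    rw [if_neg hg, qubitOrthogonality, h4, mul_one]
    refine Finset.sum_le_sum fun a _ => ?_
    split_ifs with ha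
    · refine le_mul_of_one_le_right (sq_nonneg _) ?_
      exact_mod_cast (layerCount_of_allowed _ _ _ _ hμ hν h hg
        (layerAllowed_of_ne _ _ _ _ hg ha.1 ha.2)).1
    · exact mul_nonneg (sq_nonneg _) (Nat.cast_nonneg _)

/-- For `g ≠ 0` the identity is never reached and each axis at most twice, so the Bloch ball
inequality gives `2 = 4 · 1/2`. -/
theorem sum_bloch_layerCount_le {μ ν : Fin 4} (hμ : μ ≠ 0) (hν : ν ≠ 0) (h : μ ≠ ν)
    (g : Fin 4) {r : Matrix (Fin 2) (Fin 2) ℂ} (hr : IsMixedState r) :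
    ∑ a, bloch r a ^ 2 * (layerCount μ ν g a : ℝ) ≤ 4 * if g = 0 then 1 else 1 / 2 := by
  by_cases hg : g = 0
  · subst hg
    rw [sum_bloch_layerCount_zero μ ν hr, if_pos rfl, mul_one]
  · rw [if_neg hg]
    have h0 : layerCount μ ν g 0 = 0 :=
      layerCount_of_not_allowed _ _ _ _ hμ hν h fun hc => by
        by_cases hgμ : g = μ
        · exact (hc.2.1 hgμ).1 rfl
        · exact hc.2.2 hg hgμ rfl
    have h2 : ∀ a, (layerCount μ ν g a : ℝ) ≤ 2 := fun a => by
      by_cases ha : LayerAllowed μ ν g a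
      · exact_mod_cast (layerCount_of_allowed _ _ _ _ hμ hν h hg ha).2
      · rw [layerCount_of_not_allowed _ _ _ _ hμ hν h ha]; norm_num
    rw [Fin.sum_univ_four, h0]
    have hb := bloch_sq_le_one hr
    have h3 := fun a => mul_le_mul_of_nonneg_left (h2 a) (sq_nonneg (bloch r a))
    have := h3 1
    have := h3 2
    have := h3 3
    push_cast
    linarith

/-! ### Pure states along the Pauli axes -/

/-- The pure state with Bloch vector along the axis `a`. -/
noncomputable def axisState (a : Fin 4) : Matrix (Fin 2) (Fin 2) ℂ :=
  (1 / 2 : ℂ) • (pauli 0 + pauli a)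

theorem trace_pauli_mul_axisState (a b : Fin 4) :
    (pauli b * axisState a).trace = (if b = 0 then 1 else 0) + if b = a then 1 else 0 := by
  rw [axisState, Matrix.mul_smul, Matrix.trace_smul, Matrix.mul_add, Matrix.trace_add,
    trace_pauli_mul_pauli, trace_pauli_mul_pauli]
  split_ifs <;> norm_num

theorem bloch_axisState (a b : Fin 4) :
    bloch (axisState a) b = (if b = 0 then 1 else 0) + if b = a then 1 else 0 := by
  rw [bloch, trace_pauli_mul_axisState]
  split_ifs <;> norm_num

theorem isMixedState_axisState {a : Fin 4} (ha : a ≠ 0) : IsMixedState (axisState a) := by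
  have h0 : pauli 0 = 1 := rfl
  -- The state is an orthogonal projection, which gives positivity.
  have h1 : axisState a = (axisState a)ᴴ * axisState a := by
    rw [axisState, h0, Matrix.conjTranspose_smul, Matrix.conjTranspose_add, conjTranspose_pauli,
      Matrix.conjTranspose_one, Matrix.smul_mul, Matrix.mul_smul, smul_smul, Matrix.mul_add,
      Matrix.add_mul, Matrix.add_mul, pauli_mul_self, Matrix.one_mul, Matrix.one_mul,
      Matrix.mul_one, add_comm (pauli a) 1, ← two_smul ℂ, smul_smul]
    norm_num
  refine ⟨?_, ?_⟩
  · rw [h1]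
    exact Matrix.posSemidef_conjTranspose_mul_self _
  · have h := trace_pauli_mul_axisState a 0
    rwa [h0, Matrix.one_mul, if_pos rfl, if_neg ha.symm, add_zero] at h

theorem sum_bloch_axisState {a : Fin 4} (ha : a ≠ 0) (f : Fin 4 → ℝ) :
    ∑ b, bloch (axisState a) b ^ 2 * f b = f 0 + f a := by
  have h : ∀ b, bloch (axisState a) b ^ 2 * f b =
      (if b = 0 then f b else 0) + if b = a then f b else 0 := by
    intro b
    rw [bloch_axisState]
    split_ifs with h1 h2
    · exact absurd (h2.symm.trans h1) ha
    · norm_num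
    · norm_num
    · norm_num
  simp only [h, Finset.sum_add_distrib, Finset.sum_ite_eq', Finset.mem_univ, if_true]

theorem qubitOrthogonality_axisState {μ ν : Fin 4} (hμ : μ ≠ 0) (h : μ ≠ ν) :
    qubitOrthogonality ν (axisState μ) = 1 := by
  have h1 := sum_bloch_axisState hμ fun a => if a ≠ 0 ∧ a ≠ ν then 1 else 0
  simpa [qubitOrthogonality, hμ, h] using h1

theorem discreteMean_const_mul {ι : Type} [Fintype ι] [DecidableEq ι] (x : ℝ)
    (f : (ι → ℝ) → ℝ) : discreteMean (fun θ => x * f θ) = x * discreteMean f := by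
  rw [discreteMean_eq, discreteMean_eq, ← Finset.mul_sum, mul_div_assoc]

/-! ### Averages over the layer angles with the tail angles fixed. -/

namespace PauliCircuit

variable {n : ℕ} (C : PauliCircuit n)

/-- The parameters after the two initial layers. -/
abbrev TailParam : Type := Σ k : Fin (C.K + 1), Fin (C.L k)

/-- Discrete angles, split into those of the two initial layers and the others. -/
def joinAngles (c : C.TailParam → Bool) (p : Fin n → Bool × Bool) : C.Param → Bool :=
  Sum.elim (fun i => (p i).1) (Sum.elim (fun i => (p i).2) c)

/-- Discrete angles are pairs of angles for the initial layers and for the tail. -/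
def anglesEquiv : (C.TailParam → Bool) × (Fin n → Bool × Bool) ≃ (C.Param → Bool) where
  toFun x := C.joinAngles x.1 x.2
  invFun b := (fun x => b (.inr (.inr x)), fun i => (b (.inl i), b (.inr (.inl i))))
  left_inv _ := rfl
  right_inv b := by
    funext k
    rcases k with i | i | x <;> rfl

theorem discreteMean_eq_sum (f : (C.Param → ℝ) → ℝ) :
    discreteMean f = (∑ c : C.TailParam → Bool, ∑ p : Fin n → Bool × Bool,
      f (Gate.angle (C.joinAngles c p))) / 2 ^ Fintype.card C.Param := by
  rw [discreteMean_eq, ← C.anglesEquiv.sum_comp, Fintype.sum_prod_type]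
  rfl

/-- Reduces each bound to fixed tail angles `c`, where the string entering the layers is constant.
-/
theorem discreteMean_le_of_sum_le {f g : (C.Param → ℝ) → ℝ}
    (h : ∀ c, ∑ p, f (Gate.angle (C.joinAngles c p)) ≤ ∑ p, g (Gate.angle (C.joinAngles c p))) :
    discreteMean f ≤ discreteMean g := by
  rw [discreteMean_eq_sum, discreteMean_eq_sum]
  exact div_le_div_of_nonneg_right (Finset.sum_le_sum fun c _ => h c) (by positivity)

theorem discreteMean_congr_of_sum_eq {f g : (C.Param → ℝ) → ℝ}
    (h : ∀ c, ∑ p, f (Gate.angle (C.joinAngles c p)) = ∑ p, g (Gate.angle (C.joinAngles c p))) :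
    discreteMean f = discreteMean g :=
  le_antisymm (C.discreteMean_le_of_sum_le fun c => (h c).le)
    (C.discreteMean_le_of_sum_le fun c => (h c).ge)

/-- The index of `A† P_α A` for the tail `A` at discrete angles. -/
noncomputable def tailIndex (α : PauliIndex n) (c : C.TailParam → Bool) : PauliIndex n :=
  Gate.discretePath (C.joinAngles c fun _ => (false, false)) C.tailGates α

theorem discretePath_tailGates (α : PauliIndex n) (c : C.TailParam → Bool)
    (p : Fin n → Bool × Bool) :
    Gate.discretePath (C.joinAngles c p) C.tailGates α = C.tailIndex α c := by
  rw [tailIndex]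
  refine congrFun (Gate.discretePath_congr fun k hk => ?_) α
  obtain ⟨x, rfl⟩ := (C.mem_params_tailGates k).1 hk
  rfl

theorem discretePath_gates (α : PauliIndex n) (c : C.TailParam → Bool)
    (p : Fin n → Bool × Bool) :
    Gate.discretePath (C.joinAngles c p) C.gates α = fun i =>
      rotIndex (C.ν i) (p i).1 (rotIndex (C.μ i) (p i).2 (C.tailIndex α c i)) := by
  rw [gates, Gate.discretePath_append, discretePath_tailGates, discretePath_initialGates]
  rfl

theorem conj_unitary_discrete (b : C.Param → Bool) (α : PauliIndex n) :
    (C.unitary (Gate.angle b))ᴴ * pauliString α * C.unitary (Gate.angle b) =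
        pauliString (Gate.discretePath b C.gates α) ∨
      (C.unitary (Gate.angle b))ᴴ * pauliString α * C.unitary (Gate.angle b) =
        -pauliString (Gate.discretePath b C.gates α) := by
  rw [← prod_gates, ← Gate.evolve_trig]
  exact Gate.evolve_discrete b C.gates α

theorem conj_tail_discrete (b : C.Param → Bool) (α : PauliIndex n) :
    (C.tail (Gate.angle b))ᴴ * pauliString α * C.tail (Gate.angle b) =
        pauliString (Gate.discretePath b C.tailGates α) ∨
      (C.tail (Gate.angle b))ᴴ * pauliString α * C.tail (Gate.angle b) =
        -pauliString (Gate.discretePath b C.tailGates α) := by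
  rw [← prod_tailGates, ← Gate.evolve_trig]
  exact Gate.evolve_discrete b C.tailGates α

theorem loss_discrete_sq (ρ : QOp n) (α : PauliIndex n) (b : C.Param → Bool) :
    C.loss ρ (pauliString α) (Gate.angle b) ^ 2 =
      (pauliString (Gate.discretePath b C.gates α) * ρ).trace.re ^ 2 := by
  rw [loss_eq_trace, Matrix.trace_mul_comm]
  rcases C.conj_unitary_discrete b α with h | h <;> rw [h]
  rw [Matrix.neg_mul, Matrix.trace_neg, Complex.neg_re, neg_sq]

theorem rotIndex_eq_zero (m : Fin 4) (c : Bool) (a : Fin 4) : rotIndex m c a = 0 ↔ a = 0 := by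
  revert m c a; decide

/-- Single-qubit rotations preserve the support, so the light-cone is the support of `tailIndex` and
does not depend on the layer angles. -/
theorem pow_lightCone (α : PauliIndex n) (c : C.TailParam → Bool) (p : Fin n → Bool × Bool)
    (x : ℝ) : x ^ C.lightCone α (Gate.angle (C.joinAngles c p)) =
      ∏ i, if C.tailIndex α c i = 0 then 1 else x := by
  classical
  have h : ∀ i, ¬ ActsTriviallyOn ((C.unitary (Gate.angle (C.joinAngles c p)))ᴴ * pauliString α *
      C.unitary (Gate.angle (C.joinAngles c p))) i ↔ C.tailIndex α c i ≠ 0 := by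
    intro i
    refine not_congr ?_
    have h1 : ActsTriviallyOn ((C.unitary (Gate.angle (C.joinAngles c p)))ᴴ * pauliString α *
        C.unitary (Gate.angle (C.joinAngles c p))) i ↔
        ActsTriviallyOn (pauliString (Gate.discretePath (C.joinAngles c p) C.gates α)) i := by
      rcases C.conj_unitary_discrete (C.joinAngles c p) α with h | h <;> rw [h]
      exact actsTriviallyOn_neg _ _
    rw [h1, actsTriviallyOn_pauliString, discretePath_gates, rotIndex_eq_zero, rotIndex_eq_zero]
  have h2 : C.lightCone α (Gate.angle (C.joinAngles c p)) =
      (Finset.univ.filter fun i => C.tailIndex α c i ≠ 0).card := by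
    rw [lightCone, ← Set.ncard_coe_finset]
    congr 1
    ext i
    simp only [Set.mem_ofPred_eq, h, Finset.coe_filter, Finset.mem_univ, true_and]
  rw [h2, ← Finset.prod_const, Finset.prod_filter]
  simp only [ne_eq, ite_not]

theorem sum_loss_sq (ρ : QOp n) (α : PauliIndex n) (c : C.TailParam → Bool) :
    ∑ p : Fin n → Bool × Bool,
        C.loss ρ (pauliString α) (Gate.angle (C.joinAngles c p)) ^ 2 =
      ∑ l, (pauliString l * ρ).trace.re ^ 2 *
        ∏ i, (layerCount (C.μ i) (C.ν i) (C.tailIndex α c i) (l i) : ℝ) := by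
  rw [← sum_comp_rotIndex C.μ C.ν (C.tailIndex α c) fun l => (pauliString l * ρ).trace.re ^ 2]
  simp only [loss_discrete_sq, discretePath_gates]

theorem sum_pow_lightCone (α : PauliIndex n) (c : C.TailParam → Bool) (x : ℝ) :
    ∑ p : Fin n → Bool × Bool, x ^ C.lightCone α (Gate.angle (C.joinAngles c p)) =
      ∏ i, (4 * if C.tailIndex α c i = 0 then 1 else x) := by
  simp only [pow_lightCone, Finset.sum_const, Finset.card_univ, Fintype.card_pi, Fintype.card_prod,
    Fintype.card_bool, Finset.prod_const, Fintype.card_fin, nsmul_eq_mul, Finset.prod_mul_distrib]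
  norm_num

theorem sum_loss_sq_tensor {r : Fin n → Matrix (Fin 2) (Fin 2) ℂ}
    (hr : ∀ i, IsMixedState (r i)) (α : PauliIndex n) (c : C.TailParam → Bool) :
    ∑ p : Fin n → Bool × Bool,
        C.loss (tensor r) (pauliString α) (Gate.angle (C.joinAngles c p)) ^ 2 =
      ∏ i, ∑ a, bloch (r i) a ^ 2 *
        (layerCount (C.μ i) (C.ν i) (C.tailIndex α c i) a : ℝ) := by
  simp only [sum_loss_sq, trace_pauliString_mul_tensor_sq hr, ← Finset.prod_mul_distrib,
    Finset.prod_univ_sum, Fintype.piFinset_univ]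

theorem product_lower_bound {r : Fin n → Matrix (Fin 2) (Fin 2) ℂ}
    (hr : ∀ i, IsMixedState (r i)) (α : PauliIndex n) :
    orthogonality C.ν (tensor r) * discreteMean (fun θ => (1 / 4 : ℝ) ^ C.lightCone α θ) ≤
      discreteMean (fun θ => C.loss (tensor r) (pauliString α) θ ^ 2) := by
  rw [← discreteMean_const_mul]
  refine C.discreteMean_le_of_sum_le fun c => ?_
  rw [← Finset.mul_sum, sum_pow_lightCone, sum_loss_sq_tensor C hr, orthogonality_tensor _ hr,
    ← Finset.prod_mul_distrib]
  refine Finset.prod_le_prod (fun i _ => ?_) fun i _ =>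
    le_sum_bloch_layerCount (C.μ_ne_zero i) (C.ν_ne_zero i) (C.μ_ne_ν i) _ (hr i)
  refine mul_nonneg (qubitOrthogonality_nonneg _ _) ?_
  split_ifs <;> norm_num

theorem product_upper_bound {r : Fin n → Matrix (Fin 2) (Fin 2) ℂ}
    (hr : ∀ i, IsMixedState (r i)) (α : PauliIndex n) :
    discreteMean (fun θ => C.loss (tensor r) (pauliString α) θ ^ 2) ≤
      discreteMean (fun θ => (1 / 2 : ℝ) ^ C.lightCone α θ) := by
  refine C.discreteMean_le_of_sum_le fun c => ?_
  rw [sum_pow_lightCone, sum_loss_sq_tensor C hr]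
  exact Finset.prod_le_prod
    (fun i _ => Finset.sum_nonneg fun a _ => mul_nonneg (sq_nonneg _) (Nat.cast_nonneg _))
    fun i _ => sum_bloch_layerCount_le (C.μ_ne_zero i) (C.ν_ne_zero i) (C.μ_ne_ν i) _ (hr i)

/-- Spreads `Ω(ρ, γ)` over all strings, for a termwise comparison with `sum_loss_sq`. -/
theorem genOrthogonality_mul (ρ : QOp n) (γ : PauliIndex n) (x : ℝ) :
    genOrthogonality C.ν C.μ ρ γ * x = ∑ l : PauliIndex n,
      (pauliString l * ρ).trace.re ^ 2 *
        if ∀ i, LayerAllowed (C.μ i) (C.ν i) (γ i) (l i) then x else 0 := by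
  classical
  rw [genOrthogonality, Finset.sum_filter, Finset.sum_mul]
  refine Finset.sum_congr rfl fun l _ => ?_
  by_cases h : ∀ i, LayerAllowed (C.μ i) (C.ν i) (γ i) (l i)
  · rw [if_pos h, if_pos]
    exact h
  · rw [if_neg h, if_neg fun hc => h fun i => hc i]; simp

theorem prod_le_prod_layerCount (γ l : PauliIndex n) :
    (if ∀ i, LayerAllowed (C.μ i) (C.ν i) (γ i) (l i)
      then ∏ i, (4 * if γ i = 0 then 1 else 1 / 4 : ℝ) else 0) ≤
      ∏ i, (layerCount (C.μ i) (C.ν i) (γ i) (l i) : ℝ) := by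
  split_ifs with h
  · refine Finset.prod_le_prod (fun i _ => by split_ifs <;> norm_num) fun i _ => ?_
    by_cases hg : γ i = 0
    · rw [if_pos hg, hg, layerCount_zero_index, if_pos ((h i).1 hg)]; norm_num
    · rw [if_neg hg]
      have h1 := (layerCount_of_allowed _ _ _ _ (C.μ_ne_zero i) (C.ν_ne_zero i) (C.μ_ne_ν i)
        hg (h i)).1
      have h2 : (1 : ℝ) ≤ (layerCount (C.μ i) (C.ν i) (γ i) (l i) : ℝ) := by exact_mod_cast h1
      linarith
  · exact Finset.prod_nonneg fun _ _ => Nat.cast_nonneg _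

theorem prod_layerCount_le_prod (γ l : PauliIndex n) :
    ∏ i, (layerCount (C.μ i) (C.ν i) (γ i) (l i) : ℝ) ≤
      if ∀ i, LayerAllowed (C.μ i) (C.ν i) (γ i) (l i)
        then ∏ i, (4 * if γ i = 0 then 1 else 3 / 4 : ℝ) else 0 := by
  split_ifs with h
  · refine Finset.prod_le_prod (fun _ _ => Nat.cast_nonneg _) fun i _ => ?_
    by_cases hg : γ i = 0
    · rw [if_pos hg, hg, layerCount_zero_index, if_pos ((h i).1 hg)]; norm_num
    · rw [if_neg hg]
      have h1 := (layerCount_of_allowed _ _ _ _ (C.μ_ne_zero i) (C.ν_ne_zero i) (C.μ_ne_ν i)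
        hg (h i)).2
      have h2 : (layerCount (C.μ i) (C.ν i) (γ i) (l i) : ℝ) ≤ 2 := by exact_mod_cast h1
      -- There is slack here: the count is at most `2`, while the bound is `4 · 3/4 = 3`.
      linarith
  · push Not at h
    obtain ⟨i, hi⟩ := h
    rw [Finset.prod_eq_zero (Finset.mem_univ i)]
    rw [layerCount_of_not_allowed _ _ _ _ (C.μ_ne_zero i) (C.ν_ne_zero i) (C.μ_ne_ν i) hi,
      Nat.cast_zero]

/-- The index of `A(θ)† P_α A(θ)` for angles `θ` in `{0, π/2}`. -/
noncomputable def realTailIndex (α : PauliIndex n) (θ : C.Param → ℝ) : PauliIndex n :=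
  -- Any angle other than `π/2` is read as `0`; only the values on `{0, π/2}` are used.
  Gate.discretePath (fun k => decide (θ k = Real.pi / 2)) C.tailGates α

theorem angle_decide {ι : Type} (b : ι → Bool) :
    (fun k => decide (Gate.angle b k = Real.pi / 2)) = b := by
  funext k
  have hpi : (0 : ℝ) ≠ Real.pi / 2 := Real.pi_div_two_pos.ne
  by_cases h : b k
  · simp [Gate.angle, h]
  · simpa [Gate.angle, h] using hpi

theorem realTailIndex_angle (α : PauliIndex n) (c : C.TailParam → Bool)
    (p : Fin n → Bool × Bool) :
    C.realTailIndex α (Gate.angle (C.joinAngles c p)) = C.tailIndex α c := by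
  rw [realTailIndex, angle_decide, discretePath_tailGates]

theorem conj_tail_realTailIndex (α : PauliIndex n) {θ : C.Param → ℝ}
    (hθ : ∀ k, θ k = 0 ∨ θ k = Real.pi / 2) :
    (C.tail θ)ᴴ * pauliString α * C.tail θ = pauliString (C.realTailIndex α θ) ∨
      (C.tail θ)ᴴ * pauliString α * C.tail θ = -pauliString (C.realTailIndex α θ) := by
  have h : θ = Gate.angle fun k => decide (θ k = Real.pi / 2) := by
    funext k
    by_cases hk : θ k = Real.pi / 2
    · simp [Gate.angle, hk]
    · simpa [Gate.angle, hk] using (hθ k).resolve_right hk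
  have h1 := C.conj_tail_discrete (fun k => decide (θ k = Real.pi / 2)) α
  rw [← h] at h1
  exact h1

theorem general_lower_bound_mean (ρ : QOp n) (α : PauliIndex n) :
    discreteMean (fun θ => genOrthogonality C.ν C.μ ρ (C.realTailIndex α θ) *
        (1 / 4 : ℝ) ^ C.lightCone α θ) ≤
      discreteMean (fun θ => C.loss ρ (pauliString α) θ ^ 2) := by
  refine C.discreteMean_le_of_sum_le fun c => ?_
  simp only [realTailIndex_angle]
  rw [← Finset.mul_sum, sum_pow_lightCone, sum_loss_sq, genOrthogonality_mul]
  exact Finset.sum_le_sum fun l _ =>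
    mul_le_mul_of_nonneg_left (C.prod_le_prod_layerCount _ _) (sq_nonneg _)

theorem general_upper_bound_mean (ρ : QOp n) (α : PauliIndex n) :
    discreteMean (fun θ => C.loss ρ (pauliString α) θ ^ 2) ≤
      discreteMean (fun θ => genOrthogonality C.ν C.μ ρ (C.realTailIndex α θ) *
        (3 / 4 : ℝ) ^ C.lightCone α θ) := by
  refine C.discreteMean_le_of_sum_le fun c => ?_
  simp only [realTailIndex_angle]
  rw [← Finset.mul_sum, sum_pow_lightCone, sum_loss_sq, genOrthogonality_mul]
  exact Finset.sum_le_sum fun l _ =>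
    mul_le_mul_of_nonneg_left (C.prod_layerCount_le_prod _ _) (sq_nonneg _)

end PauliCircuit

/-! ### Circuits and states attaining the product bounds. -/

theorem isClifford_one {n : ℕ} : IsClifford (1 : QOp n) :=
  ⟨one_mem _, fun Q => by simp⟩

theorem cliffordIndex_one {n : ℕ} (α : PauliIndex n) : cliffordIndex (1 : QOp n) α = α :=
  (eq_cliffordIndex (z := 1) isClifford_one (by simp)).symm

/-- The circuit consisting of two layers of rotations, the first one about the axes `α`. -/
def alignedCircuit {n : ℕ} (α : PauliIndex n) : PauliCircuit n where
  K := 0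
  W _ := 1
  clifford _ := isClifford_one
  L _ := 0
  P _ l := l.elim0
  ν i := if α i = 0 then 1 else α i
  -- Off the support of `α` the first axis is arbitrarily `1`; the second one only has to be nonzero
  -- and different from the first.
  μ i := if α i = 0 ∨ α i = 1 then 2 else 1
  ν_ne_zero i := by
    generalize α i = a
    revert a; decide
  μ_ne_zero i := by
    generalize α i = a
    revert a; decide
  μ_ne_ν i := by
    generalize α i = a
    revert a; decide

theorem alignedCircuit_ν {n : ℕ} {α : PauliIndex n} {i : Fin n} (h : α i ≠ 0) :
    (alignedCircuit α).ν i = α i := if_neg h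

theorem tailIndex_alignedCircuit {n : ℕ} (α : PauliIndex n)
    (c : (alignedCircuit α).TailParam → Bool) : (alignedCircuit α).tailIndex α c = α := by
  have h : (alignedCircuit α).tailGates = [Gate.fixed 1 isClifford_one] := rfl
  rw [PauliCircuit.tailIndex, h, Gate.discretePath, Gate.discretePath, cliffordIndex_one]

/-- The string enters the layers as `σ_ν` on its support and reaches `σ_μ` for one of the four angle
pairs. A state along `μ` sees only this pair, and its `Ω` is one. -/
theorem exists_lower_bound_attained {n : ℕ} {α : PauliIndex n} (hα : α ≠ 0) :
    ∃ (C : PauliCircuit n) (ρ : QOp n), IsProductState ρ ∧ 0 < orthogonality C.ν ρ ∧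
      paramVar (C.loss ρ (pauliString α)) =
        orthogonality C.ν ρ * discreteMean (fun θ => (1 / 4 : ℝ) ^ C.lightCone α θ) := by
  let C := alignedCircuit α
  have hr : ∀ i, IsMixedState (axisState (C.μ i)) := fun i =>
    isMixedState_axisState (C.μ_ne_zero i)
  have hΩ : orthogonality C.ν (tensor fun i => axisState (C.μ i)) = 1 := by
    rw [orthogonality_tensor _ hr]
    exact Finset.prod_eq_one fun i _ => qubitOrthogonality_axisState (C.μ_ne_zero i) (C.μ_ne_ν i)
  refine ⟨C, tensor fun i => axisState (C.μ i), ⟨_, hr, rfl⟩, by rw [hΩ]; exact one_pos, ?_⟩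
  rw [hΩ, one_mul, C.paramVar_loss_eq_discreteMean _ hα]
  refine C.discreteMean_congr_of_sum_eq fun c => ?_
  rw [C.sum_loss_sq_tensor hr, C.sum_pow_lightCone, tailIndex_alignedCircuit]
  refine Finset.prod_congr rfl fun i _ => ?_
  by_cases h : α i = 0
  · rw [h, sum_bloch_layerCount_zero _ _ (hr i), if_pos rfl, mul_one]
  · have h1 := layerCount_self _ _ (C.μ_ne_zero i) (C.ν_ne_zero i) (C.μ_ne_ν i)
    rw [if_neg h, sum_bloch_axisState (C.μ_ne_zero i), ← alignedCircuit_ν h, h1.2.1, h1.2.2]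
    norm_num

/-- `σ_ν` returns to `σ_ν` for two of the four angle pairs, and a state along `ν` has its whole
Bloch vector there. -/
theorem exists_upper_bound_attained {n : ℕ} {α : PauliIndex n} (hα : α ≠ 0) :
    ∃ (C : PauliCircuit n) (ρ : QOp n), IsProductState ρ ∧
      paramVar (C.loss ρ (pauliString α)) =
        discreteMean (fun θ => (1 / 2 : ℝ) ^ C.lightCone α θ) := by
  let C := alignedCircuit α
  have hr : ∀ i, IsMixedState (axisState (C.ν i)) := fun i =>
    isMixedState_axisState (C.ν_ne_zero i)
  refine ⟨C, tensor fun i => axisState (C.ν i), ⟨_, hr, rfl⟩, ?_⟩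
  rw [C.paramVar_loss_eq_discreteMean _ hα]
  refine C.discreteMean_congr_of_sum_eq fun c => ?_
  rw [C.sum_loss_sq_tensor hr, C.sum_pow_lightCone, tailIndex_alignedCircuit]
  refine Finset.prod_congr rfl fun i _ => ?_
  by_cases h : α i = 0
  · rw [h, sum_bloch_layerCount_zero _ _ (hr i), if_pos rfl, mul_one]
  · have h1 := layerCount_self _ _ (C.μ_ne_zero i) (C.ν_ne_zero i) (C.μ_ne_ν i)
    rw [if_neg h, sum_bloch_axisState (C.ν_ne_zero i), ← alignedCircuit_ν h, h1.1, h1.2.2]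
    norm_num

theorem theorem1 (n : ℕ) :
    (∀ (C : PauliCircuit n) (ρ : QOp n), IsMixedState ρ →
      -- independent contributions of the Pauli terms of an arbitrary observable
      (∀ c : PauliIndex n → ℝ,
        paramVar (C.loss ρ (observable c))
            = ∑ α, c α ^ 2 * paramVar (C.loss ρ (pauliString α)) ∧
        ∀ k : C.Param, paramVar (partialDeriv k (C.loss ρ (observable c)))
            = ∑ α, c α ^ 2 * paramVar (partialDeriv k (C.loss ρ (pauliString α)))) ∧
      ∀ α : PauliIndex n, α ≠ 0 →
        -- reduction to a discrete expectation; the norm is the maximum norm over the parameters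
        ‖fun k : C.Param => paramVar (partialDeriv k (C.loss ρ (pauliString α)))‖
            = paramVar (C.loss ρ (pauliString α)) ∧
        paramVar (C.loss ρ (pauliString α))
            = discreteMean (fun θ => C.loss ρ (pauliString α) θ ^ 2) ∧
        -- bounds for product states
        (IsProductState ρ →
          (orthogonality C.ν ρ * discreteMean (fun θ => (1 / 4 : ℝ) ^ C.lightCone α θ)
              ≤ paramVar (C.loss ρ (pauliString α)) ∧
            paramVar (C.loss ρ (pauliString α))
              ≤ discreteMean (fun θ => (1 / 2 : ℝ) ^ C.lightCone α θ)) ∧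
          (∃ k : C.Param,
            orthogonality C.ν ρ * discreteMean (fun θ => (1 / 4 : ℝ) ^ C.lightCone α θ)
              ≤ paramVar (partialDeriv k (C.loss ρ (pauliString α)))) ∧
          ∀ k : C.Param,
            paramVar (partialDeriv k (C.loss ρ (pauliString α)))
              ≤ discreteMean (fun θ => (1 / 2 : ℝ) ^ C.lightCone α θ)) ∧
        -- bounds for arbitrary states; `a θ` is the index of the Pauli string `A(θ)† P_α A(θ)`,
        -- with `A` the part of the circuit after the two initial layers
        ∃ a : (C.Param → ℝ) → PauliIndex n,
          (∀ θ : C.Param → ℝ, (∀ k, θ k = 0 ∨ θ k = Real.pi / 2) →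
            (C.tail θ).conjTranspose * pauliString α * C.tail θ = pauliString (a θ) ∨
            (C.tail θ).conjTranspose * pauliString α * C.tail θ = -pauliString (a θ)) ∧
          discreteMean (fun θ =>
              genOrthogonality C.ν C.μ ρ (a θ) * (1 / 4 : ℝ) ^ C.lightCone α θ)
            ≤ paramVar (C.loss ρ (pauliString α)) ∧
          paramVar (C.loss ρ (pauliString α))
            ≤ discreteMean (fun θ =>
              genOrthogonality C.ν C.μ ρ (a θ) * (3 / 4 : ℝ) ^ C.lightCone α θ)) ∧
    -- both bounds for product states are attained, for every non-trivial Pauli observable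
    (∀ α : PauliIndex n, α ≠ 0 →
      (∃ (C : PauliCircuit n) (ρ : QOp n), IsProductState ρ ∧ 0 < orthogonality C.ν ρ ∧
        paramVar (C.loss ρ (pauliString α))
          = orthogonality C.ν ρ * discreteMean (fun θ => (1 / 4 : ℝ) ^ C.lightCone α θ)) ∧
      (∃ (C : PauliCircuit n) (ρ : QOp n), IsProductState ρ ∧
        paramVar (C.loss ρ (pauliString α))
          = discreteMean (fun θ => (1 / 2 : ℝ) ^ C.lightCone α θ))) := by
  refine ⟨fun C ρ _ => ⟨fun c => ⟨C.paramVar_loss_observable ρ c,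
    C.paramVar_partialDeriv_loss_observable ρ c⟩, fun α hα => ?_⟩,
    fun α hα => ⟨exists_lower_bound_attained hα, exists_upper_bound_attained hα⟩⟩
  have hvar := C.paramVar_loss_eq_discreteMean ρ hα
  refine ⟨C.norm_paramVar_partialDeriv ρ hα, hvar, ?_,
    C.realTailIndex α, fun θ hθ => C.conj_tail_realTailIndex α hθ, ?_, ?_⟩
  · rintro ⟨r, hr, rfl⟩
    have hlow := (C.product_lower_bound hr α).trans_eq hvar.symm
    have hup := hvar.trans_le (C.product_upper_bound hr α)
    obtain ⟨k, hk⟩ := C.exists_paramVar_partialDeriv_eq (tensor r) hα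
    exact ⟨⟨hlow, hup⟩, ⟨k, hlow.trans_eq hk.symm⟩,
      fun k => (C.paramVar_partialDeriv_le (tensor r) hα k).trans hup⟩
  · rw [hvar]
    exact C.general_lower_bound_mean ρ α
  · rw [hvar]
    exact C.general_upper_bound_mean ρ α
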